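/- Let $C_6$ be the cyclic group of order $6$, and let $\mathrm{Gal}(f)$ be the Galois group over $\mathbb{Q}$ of the splitting field of $f$. A polynomial $f\in\mathbb{Z}[x]$ of degree $N$ is called monogenic if it is monic, irreducible over $\mathbb{Q}$, and, for a root $\theta$ of $f$, the set $\{1,\theta,\dots,\theta^{N-1}\}$ is a $\mathbb{Z}$-basis of the ring of integers of $\mathbb{Q}(\theta)$. It is called even if $f(-x)=f(x)$. A binomial, trinomial or quadrinomial is a polynomial with exactly two, three or four nonzero terms. "Square" means the square of an integer. (1) Let $a,b,c\in\mathbb{Z}$ with $ab=0$ and let $f(x)=x^6+ax^4+bx^2+c$ be irreducible over $\mathbb{Q}$. Then $\mathrm{Gal}(f)\not\simeq C_6$. Consequently, no even binomial or trinomial of degree $6$ in $\mathbb{Z}[x]$ is monogenic with Galois group isomorphic to $C_6$. (2) Let $a,b\in\mathbb{Z}$ and let $f(x)=x^2(x^2+a)^2+b=x^6+2ax^4+a^2x^2+b$ be irreducible over $\mathbb{Q}$. Then $\mathrm{Gal}(f)\simeq C_6$ if and only if $4a^3b-27b^2$ is a square. Let $\mathcal{F}_1$ be the set of all polynomials $x^2(x^2+a)^2+b$,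 with $a,b\in\mathbb{Z}$, that are irreducible over $\mathbb{Q}$ and for which $4a^3b-27b^2$ is a square. Then $\mathcal{F}_1$ is infinite, and the set of monogenic polynomials in $\mathcal{F}_1$ is exactly $$\mathcal{Q}_1=\{x^6-6x^4+9x^2-3,\ x^6+6x^4+9x^2+1\}.$$ (3) Let $a,b\in\mathbb{Z}$ and let $f(x)=x^6+a(bx^2+1)^2=x^6+ab^2x^4+2abx^2+a$ be irreducible over $\mathbb{Q}$. Then $\mathrm{Gal}(f)\simeq C_6$ if and only if $4ab^3-27$ is a square. Let $\mathcal{F}_2$ be the set of all polynomials $x^6+a(bx^2+1)^2$, with $a,b\in\mathbb{Z}$, that are irreducible over $\mathbb{Q}$ and for which $4ab^3-27$ is a square. Then $\mathcal{F}_2$ is infinite, and the set of monogenic polynomials in $\mathcal{F}_2$ is exactly $$\mathcal{Q}_2=\{x^6-7x^4+14x^2-7,\ x^6+9x^4+6x^2+1\}.$$ (4) For $n\in\mathbb{Z}$ let $f_n(x)=x^6+(n^2+5)x^4+(n^2+2n+6)x^2+1$. Then, for every $n\in\mathbb{Z}$, $f_n$ is irreducible over $\mathbb{Q}$, $\mathrm{Gal}(f_n)\simeq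 C_6$, and $f_n$ is monogenic if and only if $n\in\{-2,-1,0,1\}$. The set $\mathcal{F}_3=\{f_n: n\in\mathbb{Z}\}$ is infinite, and the set of monogenic polynomials in $\mathcal{F}_3$ is exactly $\mathcal{Q}_3=\{f_{-2},f_{-1},f_0,f_1\}$. (5) All elements of $\mathcal{Q}_1\cup\mathcal{Q}_2\cup\mathcal{Q}_3$ are quadrinomials, and their splitting fields (as subfields of $\mathbb{C}$) form a set of exactly four fields. The four polynomials $$x^6-6x^4+9x^2-3,\quad x^6+6x^4+9x^2+1,\quad x^6-7x^4+14x^2-7,\quad x^6+5x^4+6x^2+1$$ belong to $\mathcal{Q}_1\cup\mathcal{Q}_2\cup\mathcal{Q}_3$ and have pairwise different splitting fields, and every element of this union has the same splitting field as one of them. -/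

import Mathlib

open Polynomial IntermediateField NumberField

/-- `f ∈ ℤ[x]`, seen in `ℚ[x]`, is irreducible. -/
def IrredOverQ (f : ℤ[X]) : Prop :=
  Irreducible (f.map (Int.castRingHom ℚ))

/-- The Galois group over `ℚ` of `f ∈ ℤ[x]` (of its splitting field) is isomorphic to the cyclic
group `C_6`. -/
def GalIsoC6 (f : ℤ[X]) : Prop :=
  Nonempty ((f.map (Int.castRingHom ℚ)).Gal ≃* Multiplicative (ZMod 6))

/-- `f ∈ ℤ[x]` is monogenic: it is monic, irreducible over `ℚ` and, for every complex root `θ`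
of `f`, with `N = deg f`, the elements `1, θ, …, θ ^ (N - 1)` are a `ℤ`-basis of the ring of
integers of `ℚ(θ)`. -/
def IsMonogenic (f : ℤ[X]) : Prop :=
  f.Monic ∧ IrredOverQ f ∧
    ∀ θ : ℂ, aeval θ f = 0 →
      ∃ B : Module.Basis (Fin f.natDegree) ℤ (𝓞 ℚ⟮θ⟯),
        ∀ i : Fin f.natDegree, (((B i : 𝓞 ℚ⟮θ⟯) : ℚ⟮θ⟯) : ℂ) = θ ^ (i : ℕ)

/-- `f` is even: `f(-x) = f(x)`. -/
def IsEvenPoly (f : ℤ[X]) : Prop := f.comp (-X) = f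

/-- The splitting field of `f` over `ℚ`, as a subfield of `ℂ`. -/
noncomputable def splittingFieldInC (f : ℤ[X]) : IntermediateField ℚ ℂ :=
  IntermediateField.adjoin ℚ {θ : ℂ | aeval θ f = 0}

/-- The even sextic `x^6 + a x^4 + b x^2 + c`. -/
noncomputable def evenSextic (a b c : ℤ) : ℤ[X] :=
  X ^ 6 + C a * X ^ 4 + C b * X ^ 2 + C c

/-- `x^2 (x^2 + a)^2 + b`. -/
noncomputable def poly1 (a b : ℤ) : ℤ[X] :=
  X ^ 2 * (X ^ 2 + C a) ^ 2 + C b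

/-- `x^6 + a (b x^2 + 1)^2`. -/
noncomputable def poly2 (a b : ℤ) : ℤ[X] :=
  X ^ 6 + C a * (C b * X ^ 2 + 1) ^ 2

/-- `f_n = x^6 + (n^2 + 5) x^4 + (n^2 + 2 n + 6) x^2 + 1`. -/
noncomputable def poly3 (n : ℤ) : ℤ[X] :=
  evenSextic (n ^ 2 + 5) (n ^ 2 + 2 * n + 6) 1

def family1 : Set ℤ[X] :=
  {f | ∃ a b : ℤ, f = poly1 a b ∧ IrredOverQ f ∧ IsSquare (4 * a ^ 3 * b - 27 * b ^ 2)}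

def family2 : Set ℤ[X] :=
  {f | ∃ a b : ℤ, f = poly2 a b ∧ IrredOverQ f ∧ IsSquare (4 * a * b ^ 3 - 27)}

def family3 : Set ℤ[X] := Set.range poly3

def monoSet1 : Set ℤ[X] := {evenSextic (-6) 9 (-3), evenSextic 6 9 1}

def monoSet2 : Set ℤ[X] := {evenSextic (-7) 14 (-7), evenSextic 9 6 1}

def monoSet3 : Set ℤ[X] := {poly3 (-2), poly3 (-1), poly3 0, poly3 1}

/-- The four quadrinomials representing the different splitting fields. -/
def fourQuadrinomials : Set ℤ[X] :=
  {evenSextic (-6) 9 (-3), evenSextic 6 9 1, evenSextic (-7) 14 (-7), evenSextic 5 6 1}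

-- Every sextic here is f(x) = g(x²) with g a cubic. Suppose f is irreducible with cyclic group
-- generated by σ. Then σ³ is the automorphism θ ↦ -θ, and the squares of θ, σθ, σ²θ are the roots
-- of g. The product of their differences is σ-invariant, so disc g is a square. Complex conjugation
-- restricts to 1 or σ³, so the three distinct squares are real with a common sign, and the middle
-- coefficients cannot vanish (`coeffs_of_galIsoC6`).
--
-- Conversely, the group is C_6 once some θ·q(θ²) with q(θ²) ≠ ±1 is also a root: the automorphism
-- it defines commutes with θ ↦ -θ (`gal_cyclic_six`). In the first two families f splits over ℚ(θ)
-- into two cubics conjugate under s ↦ -s, where s² is an integer. The square condition puts the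
-- square root of the discriminant of the cofactor of x - θ into ℚ(θ), and the quadratic formula
-- gives the root. In the third family θ = ±iw with w a root of Shanks' simplest cubic, whose roots
-- are permuted by w ↦ w² - (α+1)w - 2.
--
-- If f is monogenic and N·z = h(θ) with z integral and deg h < 6, then N divides every coefficient
-- of h (`evenSextic_dvd_of_isMonogenic`). Applied to s, to the explicit conjugate and to w, this
-- leaves six polynomials. For these, ℤ[θ] is saturated at every prime: f is separable modulo p when
-- p does not divide the value of a combination uf' + vf, and at the remaining primes Dedekind's
-- criterion applies (`saturated_of_eisenstein`).
--
-- Reciprocal polynomials share a splitting field, which pairs off two of the six. The other four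
-- are told apart by their roots modulo 3, 7 and 13 (`exists_root_mod_of_splittingFieldInC_eq`).

universe u

/-! ### Even sextics: coefficients and minimal polynomials -/

theorem aeval_evenSextic {R : Type*} [CommRing R] (a b c : ℤ) (x : R) :
    aeval x (evenSextic a b c) = x ^ 6 + a * x ^ 4 + b * x ^ 2 + c := by
  simp [evenSextic]

theorem evenSextic_natDegree (a b c : ℤ) : (evenSextic a b c).natDegree = 6 := by
  unfold evenSextic; compute_degree!

theorem evenSextic_monic (a b c : ℤ) : (evenSextic a b c).Monic := by
  unfold evenSextic; monicity!

theorem evenSextic_coeff (a b c : ℤ) (n : ℕ) : (evenSextic a b c).coeff n =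
    if n = 6 then 1 else if n = 4 then a else if n = 2 then b else if n = 0 then c else 0 := by
  simp only [evenSextic, coeff_add, coeff_X_pow, coeff_C_mul, coeff_C]
  split_ifs <;> simp_all

theorem evenSextic_inj {a b c a' b' c' : ℤ} :
    evenSextic a b c = evenSextic a' b' c' ↔ a = a' ∧ b = b' ∧ c = c' := by
  refine ⟨fun h => ⟨?_, ?_, ?_⟩, ?_⟩
  · simpa [evenSextic_coeff] using congrArg (fun f => coeff f 4) h
  · simpa [evenSextic_coeff] using congrArg (fun f => coeff f 2) h
  · simpa [evenSextic_coeff] using congrArg (fun f => coeff f 0) h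
  · rintro ⟨rfl, rfl, rfl⟩; rfl

theorem poly1_eq (a b : ℤ) : poly1 a b = evenSextic (2 * a) (a ^ 2) b := by
  simp only [poly1, evenSextic, map_mul, map_pow, C_ofNat]; ring

theorem poly2_eq (a b : ℤ) : poly2 a b = evenSextic (a * b ^ 2) (2 * a * b) a := by
  simp only [poly2, evenSextic, map_mul, map_pow, C_ofNat]; ring

theorem minpoly_eq_of_irredOverQ {K : Type*} [Field K] [Algebra ℚ K] {f : ℤ[X]} (hm : f.Monic)
    (hf : IrredOverQ f) {θ : K} (hθ : aeval θ f = 0) :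
    minpoly ℚ θ = f.map (Int.castRingHom ℚ) := by
  refine (minpoly.eq_of_irreducible_of_monic hf ?_ (hm.map _)).symm
  have := aeval_map_algebraMap ℚ θ f
  rw [hθ] at this
  exact this

theorem eq_zero_of_aeval_eq_zero {K : Type*} [Field K] [Algebra ℚ K] {f : ℤ[X]} (hm : f.Monic)
    (hf : IrredOverQ f) {θ : K} (hθ : aeval θ f = 0) {p : ℚ[X]} (hp : p.degree < f.natDegree)
    (h0 : aeval θ p = 0) : p = 0 := by
  by_contra hne
  have h1 := minpoly.degree_le_of_ne_zero ℚ θ hne h0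
  rw [minpoly_eq_of_irredOverQ hm hf hθ, hm.degree_map, degree_eq_natDegree hm.ne_zero] at h1
  exact absurd hp (not_lt.2 h1)

theorem six_coeffs {K : Type*} [Field K] [Algebra ℚ K] {a b c : ℤ}
    (hf : IrredOverQ (evenSextic a b c)) {θ : K} (hθ : aeval θ (evenSextic a b c) = 0)
    {q0 q1 q2 q3 q4 q5 : ℚ}
    (h : (q0 : K) + q1 * θ + q2 * θ ^ 2 + q3 * θ ^ 3 + q4 * θ ^ 4 + q5 * θ ^ 5 = 0) :
    q0 = 0 ∧ q1 = 0 ∧ q2 = 0 ∧ q3 = 0 ∧ q4 = 0 ∧ q5 = 0 := by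
  have : CharZero K := algebraRat.charZero K
  have key := eq_zero_of_aeval_eq_zero (evenSextic_monic a b c) hf hθ
    (p := C q0 + C q1 * X + C q2 * X ^ 2 + C q3 * X ^ 3 + C q4 * X ^ 4 + C q5 * X ^ 5) (by
      rw [evenSextic_natDegree, degree_lt_iff_coeff_zero]
      intro m hm
      simp only [coeff_add, coeff_C_mul, coeff_X_pow, coeff_C, coeff_X]
      split_ifs <;> first | omega | simp) (by simpa using h)
  have hc := fun n => congrArg (fun p => coeff p n) key
  simp only [coeff_add, coeff_C_mul, coeff_X_pow, coeff_C, coeff_X] at hc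
  refine ⟨?_, ?_, ?_, ?_, ?_, ?_⟩
  · simpa using hc 0
  · simpa using hc 1
  · simpa using hc 2
  · simpa using hc 3
  · simpa using hc 4
  · simpa using hc 5

theorem sq_coeffs {K : Type*} [Field K] [Algebra ℚ K] {a b c : ℤ}
    (hf : IrredOverQ (evenSextic a b c)) {θ : K} (hθ : aeval θ (evenSextic a b c) = 0)
    {q0 q1 q2 : ℚ} (h : (q0 : K) + q1 * θ ^ 2 + q2 * (θ ^ 2) ^ 2 = 0) :
    q0 = 0 ∧ q1 = 0 ∧ q2 = 0 := by
  have := six_coeffs hf hθ (q0 := q0) (q1 := 0) (q2 := q1) (q3 := 0) (q4 := q2) (q5 := 0)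
    (by rw [← h]; push_cast; ring)
  tauto

theorem root_ne_zero {K : Type*} [Field K] [Algebra ℚ K] {a b c : ℤ}
    (hf : IrredOverQ (evenSextic a b c)) {θ : K} (hθ : aeval θ (evenSextic a b c) = 0) :
    θ ≠ 0 := by
  rintro rfl
  have := six_coeffs hf hθ (q0 := 0) (q1 := 1) (q2 := 0) (q3 := 0) (q4 := 0) (q5 := 0) (by simp)
  simp at this

theorem const_ne_zero {a b c : ℤ} (hf : IrredOverQ (evenSextic a b c)) : c ≠ 0 := by
  rintro rfl
  have : aeval (0 : ℂ) (evenSextic a b 0) = 0 := by rw [aeval_evenSextic]; simp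
  exact root_ne_zero hf this rfl

theorem exists_complex_root (a b c : ℤ) : ∃ θ : ℂ, aeval θ (evenSextic a b c) = 0 := by
  apply IsAlgClosed.exists_aeval_eq_zero_of_injective
  · exact Int.cast_injective
  · rw [degree_eq_natDegree (evenSextic_monic a b c).ne_zero, evenSextic_natDegree]; norm_num

/-! ### Irreducibility criteria -/

theorem cubic_irreducible {a b : ℤ} (h1 : a + b + 2 ≠ 0) (h2 : a ≠ b) :
    Irreducible (X ^ 3 + C (a : ℚ) * X ^ 2 + C (b : ℚ) * X + 1 : ℚ[X]) := by
  have hdeg : (X ^ 3 + C (a : ℚ) * X ^ 2 + C (b : ℚ) * X + 1 : ℚ[X]).natDegree = 3 := by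
    compute_degree!
  refine irreducible_of_degree_le_three_of_not_isRoot (by rw [hdeg]; simp) fun x hx => ?_
  have hx' : x ^ 3 + a * x ^ 2 + b * x + 1 = 0 := by simpa [IsRoot] using hx
  have hmon : (X ^ 3 + C a * X ^ 2 + C b * X + 1 : ℤ[X]).Monic := by monicity!
  obtain ⟨k, rfl⟩ : IsLocalization.IsInteger ℤ x :=
    isInteger_of_is_root_of_monic hmon (by simpa using hx')
  simp only [eq_intCast] at hx'
  have hk : k ^ 3 + a * k ^ 2 + b * k + 1 = 0 := by exact_mod_cast hx'
  have hu : IsUnit k := IsUnit.of_mul_eq_one (-(k ^ 2 + a * k + b)) (by linear_combination -hk)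
  rcases Int.isUnit_iff.1 hu with rfl | rfl
  · exact h1 (by linear_combination hk)
  · exact h2 (by linear_combination hk)

/-- The right-hand side is the norm of x, hence the square of the norm of r. -/
theorem exists_sq_eq_coeff_zero_of_gen_eq_sq {F E : Type*} [Field F] [Field E] [Algebra F E]
    {x : E} (hint : IsIntegral F x) {r : F⟮x⟯} (hr : r ^ 2 = AdjoinSimple.gen F x) :
    ∃ t : F, t ^ 2 = (-1) ^ (minpoly F x).natDegree * (minpoly F x).coeff 0 := by
  refine ⟨Algebra.norm F r, ?_⟩
  rw [← map_pow, hr]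
  have h := Algebra.PowerBasis.norm_gen_eq_coeff_zero_minpoly (adjoin.powerBasis hint)
  rwa [adjoin.powerBasis_gen, minpoly_gen, adjoin.powerBasis_dim] at h

/-- If x is a root of the irreducible cubic g, then g(X²) is irreducible unless x is a square in
ℚ(x). The norm of x is -1, which is not a rational square. -/
theorem irredOverQ_of_const_one {a b : ℤ} (h1 : a + b + 2 ≠ 0) (h2 : a ≠ b) :
    IrredOverQ (evenSextic a b 1) := by
  have hg := cubic_irreducible h1 h2
  have hgm : (X ^ 3 + C (a : ℚ) * X ^ 2 + C (b : ℚ) * X + 1 : ℚ[X]).Monic := by monicity!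
  have hcomp : (evenSextic a b 1).map (Int.castRingHom ℚ) =
      (X ^ 3 + C (a : ℚ) * X ^ 2 + C (b : ℚ) * X + 1 : ℚ[X]).comp (X ^ 2) := by
    simp only [evenSextic, Polynomial.map_add, Polynomial.map_mul, Polynomial.map_pow, map_X,
      map_C, eq_intCast (Int.castRingHom ℚ), add_comp, mul_comp, pow_comp, X_comp, C_comp,
      one_comp, Polynomial.map_one, map_one]
    ring
  unfold IrredOverQ
  rw [hcomp]
  refine irreducible_comp hgm (monic_X_pow 2) hg fun E _ _ x hx => ?_
  have hint : IsIntegral ℚ x := by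
    apply minpoly.ne_zero_iff.1
    rw [hx]; exact hgm.ne_zero
  rw [Polynomial.map_pow, map_X]
  refine X_pow_sub_C_irreducible_of_prime Nat.prime_two fun r hr => ?_
  obtain ⟨t, ht⟩ := exists_sq_eq_coeff_zero_of_gen_eq_sq hint hr
  have hdeg : (X ^ 3 + C (a : ℚ) * X ^ 2 + C (b : ℚ) * X + 1 : ℚ[X]).natDegree = 3 := by
    compute_degree!
  rw [hx, hdeg] at ht
  simp at ht
  nlinarith [sq_nonneg t]

theorem irredOverQ_of_eisenstein {a b c p : ℤ} (hp : Prime p) (ha : p ∣ a) (hb : p ∣ b)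
    (hc : p ∣ c) (hc2 : ¬ p ^ 2 ∣ c) : IrredOverQ (evenSextic a b c) := by
  have hm := evenSextic_monic a b c
  have hirr : Irreducible (evenSextic a b c) := by
    refine irreducible_of_eisenstein_criterion (P := Ideal.span {p})
      ((Ideal.span_singleton_prime hp.ne_zero).2 hp) ?_ ?_ ?_ ?_ hm.isPrimitive
    · rw [hm.leadingCoeff, Ideal.mem_span_singleton]
      exact hp.not_dvd_one
    · intro n hn
      rw [degree_eq_natDegree hm.ne_zero, evenSextic_natDegree] at hn
      have hn' : n < 6 := by exact_mod_cast hn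
      rw [Ideal.mem_span_singleton, evenSextic_coeff]
      split_ifs <;> first | omega | assumption | simp
    · rw [degree_eq_natDegree hm.ne_zero, evenSextic_natDegree]; norm_num
    · rw [Ideal.span_singleton_pow, Ideal.mem_span_singleton, evenSextic_coeff]
      simpa using hc2
  exact (hm.irreducible_iff_irreducible_map_fraction_map (K := ℚ)).1 hirr

/-! ### A criterion for Galois group C_6 -/

theorem card_eq_six_of_dvd {G : Type*} [Group G] [Finite G] (h : Nat.card G ∣ 6) {τ σ : G}
    (hτ : orderOf τ = 2) (hσ : σ ≠ 1) (hστ : σ ≠ τ) : Nat.card G = 6 := by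
  have h2 : 2 ∣ Nat.card G := hτ ▸ orderOf_dvd_natCard τ
  have hτ1 : τ ≠ 1 := by rintro rfl; simp at hτ
  have h3 : 3 ≤ Nat.card G := by
    have := Fintype.ofFinite G
    rw [Nat.card_eq_fintype_card]
    exact Fintype.two_lt_card_iff.2 ⟨1, τ, σ, hτ1.symm, hσ.symm, hστ.symm⟩
  have h6 := Nat.le_of_dvd (by norm_num) h
  interval_cases hn : Nat.card G <;> omega

/-- The counting argument of `card_eq_six_of_dvd` applies to the centralizer of τ as well, so τ is
central. Its product with an element of order 3 then has order 6. -/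
theorem isCyclic_of_commute {G : Type*} [Group G] [Finite G] (h : Nat.card G ∣ 6) {τ σ : G}
    (hτ : orderOf τ = 2) (hσ : σ ≠ 1) (hστ : σ ≠ τ) (hc : Commute τ σ) : IsCyclic G := by
  have h6 := card_eq_six_of_dvd h hτ hσ hστ
  have hH : Nat.card (Subgroup.centralizer {τ}) = 6 := by
    refine card_eq_six_of_dvd (τ := ⟨τ, ?_⟩) (σ := ⟨σ, ?_⟩)
      ((Subgroup.card_subgroup_dvd_card _).trans h) ?_ ?_ ?_
    · simp [Subgroup.mem_centralizer_singleton_iff]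
    · rw [Subgroup.mem_centralizer_singleton_iff]; exact hc.symm
    · rw [Subgroup.orderOf_mk, hτ]
    · simpa [Subtype.ext_iff] using hσ
    · simpa [Subtype.ext_iff] using hστ
  have htop := Subgroup.eq_top_of_card_eq _ (hH.trans h6.symm)
  have : Fact (Nat.Prime 3) := ⟨Nat.prime_three⟩
  obtain ⟨x, hx⟩ := exists_prime_orderOf_dvd_card' (G := G) 3 (by rw [h6]; norm_num)
  have hxc : Commute x τ := by
    have : x ∈ Subgroup.centralizer {τ} := by rw [htop]; trivial
    rw [Subgroup.mem_centralizer_singleton_iff] at this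
    exact this
  refine isCyclic_of_orderOf_eq_card (x * τ) ?_
  rw [hxc.orderOf_mul_eq_mul_orderOf_of_coprime (by rw [hx, hτ]; norm_num), hx, hτ, h6]

theorem card_algEquiv_dvd_finrank (F K : Type*) [Field F] [Field K] [Algebra F K]
    [FiniteDimensional F K] : Nat.card (K ≃ₐ[F] K) ∣ Module.finrank F K := by
  have h := IntermediateField.finrank_fixedField_eq_card (⊤ : Subgroup (K ≃ₐ[F] K))
  rw [Subgroup.card_top] at h
  rw [← h, ← Module.finrank_mul_finrank F (fixedField (⊤ : Subgroup (K ≃ₐ[F] K))) K]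
  exact dvd_mul_left _ _

/-- The work takes place in K = F[x]/(p). The automorphism τ : θ ↦ -θ fixes v = q(θ²), so it
commutes with σ : θ ↦ θv, and v ≠ ±1 makes σ different from 1 and τ. Hence Aut(K/F) is cyclic of
order 6, K is Galois over F, and K is the splitting field. -/
theorem gal_cyclic_six {F : Type u} [Field F] [CharZero F] {p : F[X]} (hp : Irreducible p)
    (hdeg : p.natDegree = 6) (q : F[X])
    (h : ∀ (K : Type u) [Field K] [Algebra F K] (θ : K), aeval θ p = 0 →
      aeval (-θ) p = 0 ∧ aeval (θ * aeval (θ ^ 2) q) p = 0 ∧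
        aeval (θ ^ 2) q ≠ 1 ∧ aeval (θ ^ 2) q ≠ -1 ∧ θ ≠ 0) :
    Nonempty (p.Gal ≃* Multiplicative (ZMod 6)) := by
  have : Fact (Irreducible p) := ⟨hp⟩
  set K := AdjoinRoot p
  set θ : K := AdjoinRoot.root p
  have hroot : aeval θ p = 0 := by rw [AdjoinRoot.aeval_eq, AdjoinRoot.mk_self]
  obtain ⟨hneg, hq, h1, h2, h0⟩ := h K θ hroot
  have : FiniteDimensional F K := (AdjoinRoot.powerBasis hp.ne_zero).finite
  have hfin : Module.finrank F K = 6 := by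
    rw [(AdjoinRoot.powerBasis hp.ne_zero).finrank, AdjoinRoot.powerBasis_dim, hdeg]
  have : CharZero K := charZero_of_injective_algebraMap (algebraMap F K).injective
  set v : K := aeval (θ ^ 2) q with hv
  have lift : ∀ β : K, aeval β p = 0 → ∃ σ : K ≃ₐ[F] K, σ θ = β := fun β hβ =>
    ⟨AlgEquiv.ofBijective (AdjoinRoot.liftAlgHom p (Algebra.ofId F K) β hβ)
      (Algebra.IsAlgebraic.algHom_bijective _),
      AdjoinRoot.liftAlgHom_root p (Algebra.ofId F K) β hβ⟩
  have ext : ∀ σ ρ : K ≃ₐ[F] K, σ θ = ρ θ → σ = ρ := fun σ ρ h => by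
    have : (σ : K →ₐ[F] K) = ρ := AdjoinRoot.algHom_ext h
    exact AlgEquiv.ext fun x => DFunLike.congr_fun this x
  obtain ⟨τ, hτ⟩ := lift _ hneg
  obtain ⟨σ, hσ⟩ := lift _ hq
  have hτv : τ v = v := by
    rw [hv, ← aeval_algHom_apply, map_pow, hτ, neg_sq]
  have hcard := hfin ▸ card_algEquiv_dvd_finrank F K
  have hτ2 : orderOf τ = 2 := by
    refine orderOf_eq_prime (ext _ _ ?_) fun h => ?_
    · rw [pow_two, AlgEquiv.mul_apply, hτ, map_neg, hτ]
      exact neg_neg θ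
    · rw [h] at hτ
      exact h0 (self_eq_neg.1 hτ)
  have hσ1 : σ ≠ 1 := by
    rintro rfl
    exact h1 (mul_left_cancel₀ h0 (by rw [← hσ]; simp))
  have hστ : σ ≠ τ := by
    rintro rfl
    exact h2 (mul_left_cancel₀ h0 (by rw [← hσ, hτ]; exact (mul_neg_one θ).symm))
  have hcomm : Commute τ σ := ext _ _ (by
    rw [AlgEquiv.mul_apply, AlgEquiv.mul_apply, hσ, hτ, map_mul, map_neg, hτ, hσ, hτv]
    exact neg_mul θ v)
  have hc6 := card_eq_six_of_dvd hcard hτ2 hσ1 hστ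
  have hcyc := isCyclic_of_commute hcard hτ2 hσ1 hστ hcomm
  have : IsGalois F K := IsGalois.of_card_aut_eq_finrank F K (hc6.trans hfin.symm)
  have hsplit : p.IsSplittingField F K := by
    refine ⟨?_, ?_⟩
    · have := Normal.splits (inferInstance : Normal F K) θ
      have hmin : minpoly F θ = p * C p.leadingCoeff⁻¹ := AdjoinRoot.minpoly_root hp.ne_zero
      have hpm : p = minpoly F θ * C p.leadingCoeff := by
        rw [hmin, mul_assoc, ← C_mul, inv_mul_cancel₀ (leadingCoeff_ne_zero.2 hp.ne_zero)]
        simp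
      have hpm' := congrArg (Polynomial.map (algebraMap F K)) hpm
      rw [hpm', Polynomial.map_mul, map_C]
      exact this.mul (Splits.C _)
    · refine top_unique ?_
      rw [← AdjoinRoot.adjoinRoot_eq_top]
      refine Algebra.adjoin_mono ?_
      rw [Set.singleton_subset_iff, mem_rootSet]
      exact ⟨hp.ne_zero, hroot⟩
  refine ⟨(AlgEquiv.autCongr (IsSplittingField.algEquiv K p)).symm.trans ?_⟩
  exact mulEquivOfCyclicCardEq (by rw [hc6]; simp)

theorem galIsoC6_of_root {a b c : ℤ} (hf : IrredOverQ (evenSextic a b c)) (q : ℚ[X])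
    (h : ∀ (K : Type) [Field K] [Algebra ℚ K] (θ : K), aeval θ (evenSextic a b c) = 0 →
      aeval (θ * aeval (θ ^ 2) q) (evenSextic a b c) = 0 ∧ (aeval (θ ^ 2) q) ^ 2 ≠ 1) :
    GalIsoC6 (evenSextic a b c) := by
  refine gal_cyclic_six hf ?_ q fun K _ _ θ hθ => ?_
  · rw [(evenSextic_monic a b c).natDegree_map, evenSextic_natDegree]
  have key : ∀ x : K, aeval x ((evenSextic a b c).map (Int.castRingHom ℚ)) =
      aeval x (evenSextic a b c) := fun x => aeval_map_algebraMap ℚ x _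
  rw [key] at hθ
  obtain ⟨h1, h2⟩ := h K θ hθ
  refine ⟨?_, by rw [key, h1], fun h => h2 (by rw [h]; simp), fun h => h2 (by rw [h]; simp),
    root_ne_zero hf hθ⟩
  rw [aeval_evenSextic] at hθ
  rw [key, aeval_evenSextic]
  linear_combination hθ

/-! ### Necessary conditions for Galois group C_6 -/

theorem adjoin_rootSet_eq_adjoin_simple {F L : Type*} [Field F] [CharZero F] [Field L] [Algebra F L]
    {p : F[X]} (hp : Irreducible p) (hs : (p.map (algebraMap F L)).Splits)
    (hcard : Nat.card p.Gal = p.natDegree) {θ : L} (hθ : aeval θ p = 0) :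
    adjoin F (p.rootSet L) = F⟮θ⟯ := by
  have hK := adjoin_rootSet_isSplittingField hs
  have hfd := IsSplittingField.finiteDimensional (adjoin F (p.rootSet L)) p
  refine (eq_of_le_of_finrank_eq ?_ ?_).symm
  · rw [adjoin_simple_le_iff]
    exact subset_adjoin F _ (mem_rootSet.2 ⟨hp.ne_zero, hθ⟩)
  · rw [(IsSplittingField.algEquiv (adjoin F (p.rootSet L)) p).toLinearEquiv.finrank_eq,
      ← Gal.card_of_separable hp.separable, hcard]
    have hi : IsIntegral F θ := ⟨_, monic_mul_leadingCoeff_inv hp.ne_zero, by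
      rw [← aeval_def, map_mul, hθ, zero_mul]⟩
    rw [adjoin.finrank hi, ← minpoly.eq_of_irreducible hp hθ,
      natDegree_mul_leadingCoeff_inv _ hp.ne_zero]

/-- With σ a generator, θ₂ = σθ and θ₃ = σ²θ. The only involution of C_6 is σ³, which must be θ ↦
-θ, so σ permutes the three squares cyclically and fixes the product of their differences. An
involution χ of L restricts to 1 or σ³ on the splitting field. -/
theorem cyclic_six_orbit {F L : Type*} [Field F] [CharZero F] [Field L] [Algebra F L]
    {p : F[X]} (hp : Irreducible p) (hs : (p.map (algebraMap F L)).Splits)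
    (hdeg : p.natDegree = 6) (hG : Nonempty (p.Gal ≃* Multiplicative (ZMod 6)))
    {θ : L} (hθ : aeval θ p = 0) (hneg : aeval (-θ) p = 0) (h0 : θ ≠ 0) :
    ∃ θ₂ θ₃ : L, aeval θ₂ p = 0 ∧ aeval θ₃ p = 0 ∧
      θ ^ 2 ≠ θ₂ ^ 2 ∧ θ₂ ^ 2 ≠ θ₃ ^ 2 ∧ θ₃ ^ 2 ≠ θ ^ 2 ∧
      (∃ d : F, (θ ^ 2 - θ₂ ^ 2) * (θ₂ ^ 2 - θ₃ ^ 2) * (θ₃ ^ 2 - θ ^ 2) = algebraMap F L d) ∧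
      ∀ χ : L ≃ₐ[F] L, (∀ x, χ (χ x) = x) →
        (χ θ = θ ∧ χ θ₂ = θ₂ ∧ χ θ₃ = θ₃) ∨ (χ θ = -θ ∧ χ θ₂ = -θ₂ ∧ χ θ₃ = -θ₃) := by
  have : CharZero L := charZero_of_injective_algebraMap (algebraMap F L).injective
  obtain ⟨e₀⟩ := hG
  have hcard : Nat.card p.Gal = p.natDegree := by
    rw [hdeg, Nat.card_congr e₀.toEquiv]; simp
  have hadj := adjoin_rootSet_eq_adjoin_simple hp hs hcard hθ
  have hsf := adjoin_rootSet_isSplittingField hs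
  set K := adjoin F (p.rootSet L) with hK
  have hfd := IsSplittingField.finiteDimensional K p
  have hgal : IsGalois F K := IsGalois.of_separable_splitting_field hp.separable (E := K)
  have e : (K ≃ₐ[F] K) ≃* Multiplicative (ZMod 6) :=
    (AlgEquiv.autCongr (IsSplittingField.algEquiv K p)).trans e₀
  have hθK : θ ∈ K := subset_adjoin F _ (mem_rootSet.2 ⟨hp.ne_zero, hθ⟩)
  set t : K := ⟨θ, hθK⟩ with ht
  have ht0 : t ≠ 0 := fun h => h0 (congrArg Subtype.val h)
  have ext : ∀ σ ρ : K ≃ₐ[F] K, σ t = ρ t → σ = ρ := fun σ ρ h => by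
    have : (σ : K →ₐ[F] K) = ρ := by
      refine algHom_ext_of_eq_adjoin F hadj fun x hx => ?_
      obtain rfl : x = θ := hx
      exact h
    exact AlgEquiv.ext fun x => DFunLike.congr_fun this x
  have comm : ∀ σ ρ : K ≃ₐ[F] K, σ * ρ = ρ * σ := fun σ ρ => e.injective (by
    rw [map_mul, map_mul, mul_comm])
  have hroot : ∀ x : K, aeval (x : L) p = algebraMap K L (aeval x p) := fun x =>
    aeval_algebraMap_apply L x p
  have htr : aeval t p = 0 := by
    apply (algebraMap K L).injective
    rw [← hroot, map_zero, hθ]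
  have hntr : aeval (-t) p = 0 := by
    apply (algebraMap K L).injective
    rw [← hroot, map_zero]; exact hneg
  obtain ⟨τ, hτ⟩ : ∃ τ : K ≃ₐ[F] K, τ t = -t := by
    refine minpoly.exists_algEquiv_of_root' (Algebra.IsAlgebraic.isAlgebraic t) ?_
    rw [← minpoly.eq_of_irreducible hp htr, map_mul, hntr, zero_mul]
  set σ : K ≃ₐ[F] K := e.symm (Multiplicative.ofAdd 1) with hσ
  have hpow : ∀ n : ℕ, σ ^ n = e.symm (Multiplicative.ofAdd (n : ZMod 6)) := fun n => by
    rw [hσ, ← map_pow, ← ofAdd_nsmul, nsmul_one]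
  have invol : ∀ g : K ≃ₐ[F] K, g * g = 1 → g = 1 ∨ g = σ ^ 3 := by
    intro g hg
    have h1 : ∀ x : ZMod 6, x + x = 0 → x = 0 ∨ x = 3 := by decide
    have h2 := congrArg (fun x => Multiplicative.toAdd (e x)) hg
    simp only [map_mul, toAdd_mul, map_one, toAdd_one] at h2
    rcases h1 _ h2 with h | h
    · left
      apply e.injective
      rw [map_one]; exact h
    · right
      rw [hpow]
      apply e.injective
      rw [MulEquiv.apply_symm_apply]; exact h
  have hττ : τ * τ = 1 := ext _ _ (by rw [AlgEquiv.mul_apply, hτ, map_neg, hτ, neg_neg]; rfl)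
  have hτ3 : τ = σ ^ 3 := by
    refine (invol τ hττ).resolve_left fun h => ht0 ?_
    rw [h] at hτ
    exact self_eq_neg.1 hτ
  have hpne : ∀ n : ℕ, (n : ZMod 6) ≠ 0 → (n : ZMod 6) ≠ 3 →
      ((σ ^ n) t) ^ 2 ≠ t ^ 2 := by
    intro n hn hn3 h
    rcases sq_eq_sq_iff_eq_or_eq_neg.1 h with h | h
    · have := ext _ 1 h
      rw [hpow] at this
      have := e.symm.injective (this.trans (map_one e.symm).symm)
      exact hn this
    · have := ext _ τ (h.trans hτ.symm)
      rw [hτ3, hpow, hpow] at this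
      exact hn3 (e.symm.injective this)
  have hτt : ∀ g : K ≃ₐ[F] K, τ (g t) = -(g t) := fun g => by
    rw [← AlgEquiv.mul_apply, comm, AlgEquiv.mul_apply, hτ, map_neg]
  have hσσσ : σ (σ (σ t)) = -t := by
    rw [← hτ, hτ3]; rfl
  have hrt : ∀ g : K ≃ₐ[F] K, aeval ((g t : K) : L) p = 0 := fun g => by
    have : aeval (g t) p = 0 := by
      rw [show g t = (g : K →ₐ[F] K) t from rfl, aeval_algHom_apply, htr, map_zero]
    rw [hroot, this, map_zero]
  have inj : ∀ x y : K, x ^ 2 ≠ y ^ 2 → (x : L) ^ 2 ≠ (y : L) ^ 2 := fun x y h h' =>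
    h (Subtype.ext (by simpa using h'))
  have n1 : (σ t) ^ 2 ≠ t ^ 2 := by
    simpa using hpne 1 (by decide) (by decide)
  have n2 : (σ (σ t)) ^ 2 ≠ t ^ 2 := by
    have := hpne 2 (by decide) (by decide)
    rwa [pow_two σ, AlgEquiv.mul_apply] at this
  refine ⟨σ t, σ (σ t), hrt σ, hrt (σ * σ), (inj _ _ n1).symm, (inj _ _ ?_).symm, inj _ _ n2,
    ?_, ?_⟩
  · exact fun h => n1 (σ.injective (by rw [map_pow, map_pow]; exact h))
  · set D : K := (t ^ 2 - (σ t) ^ 2) * ((σ t) ^ 2 - (σ (σ t)) ^ 2) * ((σ (σ t)) ^ 2 - t ^ 2)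
    have hD : σ D = D := by
      simp only [D, map_mul, map_sub, map_pow, hσσσ]
      ring
    have hDn : ∀ n : ℕ, (σ ^ n) D = D := by
      intro n
      induction n with
      | zero => rfl
      | succ n ih => rw [pow_succ, AlgEquiv.mul_apply, hD, ih]
    have hfix : ∀ g : K ≃ₐ[F] K, g D = D := fun g => by
      have : g = σ ^ (Multiplicative.toAdd (e g)).val := by
        rw [hpow]
        apply e.injective
        rw [MulEquiv.apply_symm_apply, ZMod.natCast_zmod_val]; rfl
      rw [this, hDn]
    obtain ⟨d, hd⟩ := (IsGalois.mem_range_algebraMap_iff_fixed D).2 hfix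
    refine ⟨d, ?_⟩
    have := congrArg (algebraMap K L) hd
    rw [← IsScalarTower.algebraMap_apply] at this
    rw [this]
    rfl
  · intro χ hχ
    set κ : K ≃ₐ[F] K := χ.restrictNormal K
    have hκ : ∀ x : K, ((κ x : K) : L) = χ x := χ.restrictNormal_commutes K
    have hκκ : κ * κ = 1 := AlgEquiv.ext fun x => Subtype.ext (by
      rw [AlgEquiv.mul_apply, hκ, hκ, hχ]; rfl)
    rcases invol κ hκκ with h | h
    · left
      refine ⟨?_, ?_, ?_⟩
      · rw [← hκ t, h]; rfl
      · rw [← hκ (σ t), h]; rfl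
      · rw [← hκ (σ (σ t)), h]; rfl
    · right
      rw [← hτ3] at h
      refine ⟨?_, ?_, ?_⟩
      · rw [← hκ t, h, hτ]; rfl
      · rw [← hκ (σ t), h, hτt σ]; rfl
      · rw [← hκ (σ (σ t)), h, ← AlgEquiv.mul_apply σ σ, hτt (σ * σ)]; rfl

theorem splittingFieldInC_eq_adjoin_simple {f : ℤ[X]} (hm : f.Monic) (hf : IrredOverQ f)
    (hdeg : f.natDegree = 6) (hG : GalIsoC6 f) {θ : ℂ} (hθ : aeval θ f = 0) :
    splittingFieldInC f = ℚ⟮θ⟯ := by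
  have key : ∀ x : ℂ, aeval x (f.map (Int.castRingHom ℚ)) = aeval x f := fun x =>
    aeval_map_algebraMap ℚ x _
  have hset : {θ : ℂ | aeval θ f = 0} = (f.map (Int.castRingHom ℚ)).rootSet ℂ := by
    ext x
    rw [mem_rootSet, key]
    simp [(hm.map (Int.castRingHom ℚ)).ne_zero]
  obtain ⟨e⟩ := hG
  rw [splittingFieldInC, hset]
  refine adjoin_rootSet_eq_adjoin_simple hf (IsAlgClosed.splits _) ?_ ((key θ).trans hθ)
  rw [Nat.card_congr e.toEquiv, hm.natDegree_map, hdeg]; simp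

theorem cubic_vieta {R : Type*} [Field R] {a b c x y z : R}
    (hx : x ^ 3 + a * x ^ 2 + b * x + c = 0) (hy : y ^ 3 + a * y ^ 2 + b * y + c = 0)
    (hz : z ^ 3 + a * z ^ 2 + b * z + c = 0) (hxy : x ≠ y) (hyz : y ≠ z) (hzx : z ≠ x) :
    a = -(x + y + z) ∧ b = x * y + y * z + z * x ∧ c = -(x * y * z) := by
  have h1 : x ^ 2 + x * y + y ^ 2 + a * (x + y) + b = 0 :=
    mul_left_cancel₀ (sub_ne_zero.2 hxy) (by linear_combination hx - hy)
  have h2 : y ^ 2 + y * z + z ^ 2 + a * (y + z) + b = 0 :=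
    mul_left_cancel₀ (sub_ne_zero.2 hyz) (by linear_combination hy - hz)
  have h3 : a + (x + y + z) = 0 :=
    mul_left_cancel₀ (sub_ne_zero.2 hzx) (by linear_combination h2 - h1)
  have ha : a = -(x + y + z) := by linear_combination h3
  subst ha
  have hb : b = x * y + y * z + z * x := by linear_combination h1
  subst hb
  exact ⟨rfl, rfl, by linear_combination hx⟩

theorem coeffs_of_galIsoC6 {a b c : ℤ} (hf : IrredOverQ (evenSextic a b c))
    (hG : GalIsoC6 (evenSextic a b c)) :
    IsSquare (a ^ 2 * b ^ 2 - 4 * b ^ 3 - 4 * a ^ 3 * c - 27 * c ^ 2 + 18 * a * b * c) ∧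
      a ≠ 0 ∧ b ≠ 0 := by
  obtain ⟨θ, hθ⟩ := exists_complex_root a b c
  have key : ∀ x : ℂ, aeval x ((evenSextic a b c).map (Int.castRingHom ℚ)) =
      aeval x (evenSextic a b c) := fun x => aeval_map_algebraMap ℚ x _
  obtain ⟨θ₂, θ₃, h2, h3, n12, n23, n31, ⟨d, hd⟩, hconj⟩ :=
    cyclic_six_orbit hf (IsAlgClosed.splits _)
      (by rw [(evenSextic_monic a b c).natDegree_map, evenSextic_natDegree]) hG
      ((key θ).trans hθ) (by
        rw [key, aeval_evenSextic]
        rw [aeval_evenSextic] at hθ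
        linear_combination hθ) (root_ne_zero hf hθ)
  rw [key, aeval_evenSextic] at h2 h3
  rw [aeval_evenSextic] at hθ
  obtain ⟨va, vb, vc⟩ := cubic_vieta (a := (a : ℂ)) (b := b) (c := c)
    (x := θ ^ 2) (y := θ₂ ^ 2) (z := θ₃ ^ 2)
    (by linear_combination hθ) (by linear_combination h2) (by linear_combination h3) n12 n23 n31
  refine ⟨?_, ?_⟩
  · rw [← Rat.isSquare_intCast_iff]
    refine ⟨d, ?_⟩
    have : ((a ^ 2 * b ^ 2 - 4 * b ^ 3 - 4 * a ^ 3 * c - 27 * c ^ 2 + 18 * a * b * c : ℤ) : ℂ) =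
        algebraMap ℚ ℂ d * algebraMap ℚ ℂ d := by
      rw [← hd]
      push_cast
      rw [va, vb, vc]
      ring
    apply (algebraMap ℚ ℂ).injective
    rw [map_mul, ← this, map_intCast]
  -- By `hconj` for complex conjugation, the three roots are all real (ε = 1) or all purely
  -- imaginary (ε = -1).
  have hsq : ∃ r r₂ r₃ ε : ℝ, ε ^ 2 = 1 ∧ θ ^ 2 = (ε * r ^ 2 : ℝ) ∧ θ₂ ^ 2 = (ε * r₂ ^ 2 : ℝ) ∧
      θ₃ ^ 2 = (ε * r₃ ^ 2 : ℝ) := by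
    have real : ∀ x : ℂ, (starRingEnd ℂ) x = x → x ^ 2 = ((1 : ℝ) * x.re ^ 2 : ℝ) := fun x hx => by
      obtain ⟨r, rfl⟩ := Complex.conj_eq_iff_real.1 hx
      rw [one_mul, Complex.ofReal_re, Complex.ofReal_pow]
    have imag : ∀ x : ℂ, (starRingEnd ℂ) x = -x → x ^ 2 = ((-1 : ℝ) * x.im ^ 2 : ℝ) := by
      intro x hx
      have h0 : x.re = 0 := by
        have := congrArg Complex.re hx
        simp at this
        linarith
      apply Complex.ext <;> simp [pow_two, h0]
    let χ : ℂ ≃ₐ[ℚ] ℂ := AlgEquiv.ofRingEquiv (f := starRingAut) (fun r => by simp)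
    rcases hconj χ (fun x => Complex.conj_conj x) with ⟨h, h', h''⟩ | ⟨h, h', h''⟩
    · exact ⟨_, _, _, 1, by norm_num, real _ h, real _ h', real _ h''⟩
    · exact ⟨_, _, _, -1, by norm_num, imag _ h, imag _ h', imag _ h''⟩
  obtain ⟨r, r₂, r₃, ε, hε, e1, e2, e3⟩ := hsq
  rw [e1, e2, e3] at va vb
  rw [e1, e2] at n12
  rw [e2, e3] at n23
  rw [e3, e1] at n31
  have va' : (a : ℝ) = -(ε * r ^ 2 + ε * r₂ ^ 2 + ε * r₃ ^ 2) := by exact_mod_cast va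
  have vb' : (b : ℝ) = ε * r ^ 2 * (ε * r₂ ^ 2) + ε * r₂ ^ 2 * (ε * r₃ ^ 2) +
    ε * r₃ ^ 2 * (ε * r ^ 2) := by exact_mod_cast vb
  have m12 : ε * r ^ 2 ≠ ε * r₂ ^ 2 := by exact_mod_cast n12
  have m23 : ε * r₂ ^ 2 ≠ ε * r₃ ^ 2 := by exact_mod_cast n23
  have m31 : ε * r₃ ^ 2 ≠ ε * r ^ 2 := by exact_mod_cast n31
  have hε0 : ε ≠ 0 := by rintro rfl; norm_num at hε
  -- Up to sign, a is the sum of the r_i² and b is the sum of their pairwise products. Either one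
  -- being zero would make two of the squares vanish, against distinctness.
  constructor
  · rintro rfl
    have h0 : r ^ 2 + r₂ ^ 2 + r₃ ^ 2 = 0 :=
      mul_left_cancel₀ hε0 (by push_cast at va'; linear_combination va')
    have h1 : r ^ 2 = 0 := by nlinarith [sq_nonneg r, sq_nonneg r₂, sq_nonneg r₃]
    have h2 : r₂ ^ 2 = 0 := by nlinarith [sq_nonneg r, sq_nonneg r₂, sq_nonneg r₃]
    exact m12 (by rw [h1, h2])
  · rintro rfl
    have h0 : r ^ 2 * r₂ ^ 2 + r₂ ^ 2 * r₃ ^ 2 + r₃ ^ 2 * r ^ 2 = 0 := by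
      push_cast at vb'
      linear_combination -vb' - (r ^ 2 * r₂ ^ 2 + r₂ ^ 2 * r₃ ^ 2 + r₃ ^ 2 * r ^ 2) * hε
    have p1 : 0 ≤ r ^ 2 * r₂ ^ 2 := by positivity
    have p2 : 0 ≤ r₂ ^ 2 * r₃ ^ 2 := by positivity
    have p3 : 0 ≤ r₃ ^ 2 * r ^ 2 := by positivity
    have q1 : r ^ 2 * r₂ ^ 2 = 0 := by linarith
    have q2 : r₂ ^ 2 * r₃ ^ 2 = 0 := by linarith
    have q3 : r₃ ^ 2 * r ^ 2 = 0 := by linarith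
    rcases mul_eq_zero.1 q2 with h | h
    · rcases mul_eq_zero.1 q3 with h' | h'
      · exact m23 (by rw [h, h'])
      · exact m12 (by rw [h, h'])
    · rcases mul_eq_zero.1 q1 with h' | h'
      · exact m31 (by rw [h, h'])
      · exact m23 (by rw [h, h'])

/-! ### Divisibility forced by monogenicity -/

theorem dvd_of_aeval_eq_zero {f : ℤ[X]} (hm : f.Monic) (hf : IrredOverQ f) {θ : ℂ}
    (hθ : aeval θ f = 0) {g : ℤ[X]} (hg : aeval θ g = 0) : f ∣ g := by
  rw [← modByMonic_eq_zero_iff_dvd hm]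
  have h1 : aeval θ (g %ₘ f) = 0 := by
    have := congrArg (aeval θ) (modByMonic_add_div g f)
    rwa [map_add, map_mul, hθ, zero_mul, add_zero, hg] at this
  have h2 : (g %ₘ f).map (Int.castRingHom ℚ) = 0 := by
    refine eq_zero_of_aeval_eq_zero hm hf hθ ?_ ((aeval_map_algebraMap ℚ θ _).trans h1)
    refine (degree_map_le).trans_lt ?_
    rw [← degree_eq_natDegree hm.ne_zero]
    exact degree_modByMonic_lt _ hm
  exact (Polynomial.map_eq_zero_iff Int.cast_injective).1 h2

theorem exists_aeval_of_isMonogenic {f : ℤ[X]} (hM : IsMonogenic f) {θ : ℂ} (hθ : aeval θ f = 0)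
    {z : ℂ} (hz : IsIntegral ℤ z) (hzθ : z ∈ ℚ⟮θ⟯) :
    ∃ p : ℤ[X], p.degree < f.natDegree ∧ aeval θ p = z := by
  obtain ⟨-, -, h⟩ := hM
  obtain ⟨B, hB⟩ := h θ hθ
  have hz' : IsIntegral ℤ (⟨z, hzθ⟩ : ℚ⟮θ⟯) :=
    (isIntegral_algebraMap_iff (algebraMap ℚ⟮θ⟯ ℂ).injective).1 hz
  let ζ : 𝓞 ℚ⟮θ⟯ := ⟨⟨z, hzθ⟩, hz'⟩
  refine ⟨∑ i : Fin f.natDegree, monomial (i : ℕ) (B.repr ζ i), ?_, ?_⟩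
  · refine (degree_sum_le _ _).trans_lt ?_
    rw [Finset.sup_lt_iff (WithBot.bot_lt_coe _)]
    intro i _
    exact (degree_monomial_le _ _).trans_lt (by exact_mod_cast i.2)
  · have h1 := congrArg (fun x : 𝓞 ℚ⟮θ⟯ => ((x : ℚ⟮θ⟯) : ℂ)) (B.sum_repr ζ)
    simp only [zsmul_eq_mul, map_sum, map_mul, map_intCast] at h1
    rw [map_sum]
    simp only [aeval_monomial]
    refine Eq.trans ?_ h1
    push_cast
    refine Finset.sum_congr rfl fun i _ => ?_
    rw [hB]
    simp

/-- Monogenicity gives h(θ)/N = p(θ) with p integral of degree below deg f. Then N·p - h is a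
multiple of f of smaller degree, so it is zero. -/
theorem dvd_coeff_of_isMonogenic {f : ℤ[X]} (hM : IsMonogenic f) {θ : ℂ} (hθ : aeval θ f = 0)
    {N : ℤ} (hN : N ≠ 0) {h : ℤ[X]} (hd : h.degree < f.natDegree)
    (hz : IsIntegral ℤ (aeval θ h / N : ℂ)) (n : ℕ) : N ∣ h.coeff n := by
  have hmem : (aeval θ h / N : ℂ) ∈ ℚ⟮θ⟯ := by
    refine div_mem ?_ (intCast_mem _ _)
    rw [aeval_eq_sum_range]
    refine sum_mem fun i _ => ?_
    rw [zsmul_eq_mul]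
    exact mul_mem (intCast_mem _ _) (pow_mem (mem_adjoin_simple_self ℚ θ) _)
  obtain ⟨p, hp, hpz⟩ := exists_aeval_of_isMonogenic hM hθ hz hmem
  have hN' : (N : ℂ) ≠ 0 := by exact_mod_cast hN
  have h0 : aeval θ (C N * p - h) = 0 := by
    rw [map_sub, map_mul, hpz, aeval_C]
    simp only [eq_intCast]
    field_simp
    ring
  have hdvd := dvd_of_aeval_eq_zero hM.1 hM.2.1 hθ h0
  have hlt : (C N * p - h).degree < f.degree := by
    rw [degree_eq_natDegree hM.1.ne_zero]
    refine (degree_sub_le _ _).trans_lt (max_lt (lt_of_le_of_lt ?_ hp) hd)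
    rw [degree_C_mul hN]
  have heq := eq_zero_of_dvd_of_degree_lt hdvd hlt
  have := congrArg (fun q => coeff q n) heq
  simp only [coeff_sub, coeff_C_mul, coeff_zero] at this
  exact ⟨_, (sub_eq_zero.1 this).symm⟩

theorem evenSextic_dvd_of_isMonogenic {a b c : ℤ} (hM : IsMonogenic (evenSextic a b c)) {θ : ℂ}
    (hθ : aeval θ (evenSextic a b c) = 0) {N : ℤ} (hN : N ≠ 0) {h₀ h₁ h₂ h₃ h₄ h₅ : ℤ} {z : ℂ}
    (hz : IsIntegral ℤ z)
    (hzN : N * z = h₀ + h₁ * θ + h₂ * θ ^ 2 + h₃ * θ ^ 3 + h₄ * θ ^ 4 + h₅ * θ ^ 5) :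
    N ∣ h₀ ∧ N ∣ h₁ ∧ N ∣ h₂ ∧ N ∣ h₃ ∧ N ∣ h₄ ∧ N ∣ h₅ := by
  set h : ℤ[X] := C h₀ + C h₁ * X + C h₂ * X ^ 2 + C h₃ * X ^ 3 + C h₄ * X ^ 4 + C h₅ * X ^ 5
    with hh
  have hN' : (N : ℂ) ≠ 0 := by exact_mod_cast hN
  have hzh : aeval θ h / N = z := by
    rw [div_eq_iff hN', mul_comm, hzN]
    simp [hh]
  have key := dvd_coeff_of_isMonogenic hM hθ hN (h := h) (by
      rw [evenSextic_natDegree, degree_lt_iff_coeff_zero]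
      intro m hm
      simp only [hh, coeff_add, coeff_C_mul, coeff_X_pow, coeff_C, coeff_X]
      split_ifs <;> omega) (by rw [hzh]; exact hz)
  simp only [hh, coeff_add, coeff_C_mul, coeff_X_pow, coeff_C, coeff_X] at key
  refine ⟨?_, ?_, ?_, ?_, ?_, ?_⟩
  · simpa using key 0
  · simpa using key 1
  · simpa using key 2
  · simpa using key 3
  · simpa using key 4
  · simpa using key 5

/-! ### Proving monogenicity prime by prime -/

theorem isMonogenic_of_forall_integral {f : ℤ[X]} (hm : f.Monic) (hf : IrredOverQ f)
    (h : ∀ θ : ℂ, aeval θ f = 0 → ∀ z ∈ ℚ⟮θ⟯, IsIntegral ℤ z → ∃ p : ℤ[X], aeval θ p = z) :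
    IsMonogenic f := by
  refine ⟨hm, hf, fun θ hθ => ?_⟩
  have hint : IsIntegral ℤ θ := ⟨f, hm, hθ⟩
  have hg : IsIntegral ℤ (AdjoinSimple.gen ℚ θ) :=
    (isIntegral_algebraMap_iff (algebraMap ℚ⟮θ⟯ ℂ).injective).1 hint
  let t : 𝓞 ℚ⟮θ⟯ := ⟨AdjoinSimple.gen ℚ θ, hg⟩
  let v : Fin f.natDegree → 𝓞 ℚ⟮θ⟯ := fun i => t ^ (i : ℕ)
  let ι : 𝓞 ℚ⟮θ⟯ →+* ℂ := (algebraMap ℚ⟮θ⟯ ℂ).comp (algebraMap (𝓞 ℚ⟮θ⟯) ℚ⟮θ⟯)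
  have hι : Function.Injective ι :=
    (algebraMap ℚ⟮θ⟯ ℂ).injective.comp RingOfIntegers.coe_injective
  have hιt : ι t = θ := rfl
  have hli : LinearIndependent ℤ v := by
    rw [Fintype.linearIndependent_iff]
    intro c hc i
    have h1 : aeval θ (∑ i : Fin f.natDegree, monomial (i : ℕ) (c i)) = 0 := by
      have := congrArg ι hc
      rw [map_zero, map_sum] at this
      rw [map_sum, ← this]
      refine Finset.sum_congr rfl fun i _ => ?_
      rw [aeval_monomial, zsmul_eq_mul, map_mul, map_intCast, map_pow, hιt]
      simp
    have h2 := eq_zero_of_dvd_of_degree_lt (dvd_of_aeval_eq_zero hm hf hθ h1) (by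
      rw [degree_eq_natDegree hm.ne_zero]
      refine (degree_sum_le _ _).trans_lt ?_
      rw [Finset.sup_lt_iff (WithBot.bot_lt_coe _)]
      intro i _
      exact (degree_monomial_le _ _).trans_lt (by exact_mod_cast i.2))
    have h3 := congrArg (fun q => coeff q (i : ℕ)) h2
    simpa [finsetSum_coeff, coeff_monomial, Fin.val_inj] using h3
  have hsp : ⊤ ≤ Submodule.span ℤ (Set.range v) := by
    intro z _
    have hz : IsIntegral ℤ (ι z) := z.isIntegral_coe.map (algebraMap ℚ⟮θ⟯ ℂ).toIntAlgHom
    obtain ⟨p, hp⟩ := h θ hθ (ι z) (SetLike.coe_mem _) hz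
    have hp' : aeval θ (p %ₘ f) = ι z := by
      have := congrArg (aeval θ) (modByMonic_add_div p f)
      rwa [map_add, map_mul, hθ, zero_mul, add_zero, hp] at this
    have hpos : f.natDegree ≠ 0 := fun h0 => by
      rw [hm.natDegree_eq_zero.1 h0] at hθ
      simp at hθ
    have hlt : (p %ₘ f).natDegree < f.natDegree := natDegree_modByMonic_lt _ hm fun h1 =>
      hpos (by rw [h1, natDegree_one])
    rw [aeval_eq_sum_range' hlt] at hp'
    have : z = ∑ i ∈ Finset.range f.natDegree, (p %ₘ f).coeff i • t ^ i := by
      apply hι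
      rw [← hp', map_sum]
      refine Finset.sum_congr rfl fun i _ => ?_
      rw [zsmul_eq_mul, zsmul_eq_mul, map_mul, map_intCast, map_pow, hιt]
    rw [this]
    refine Submodule.sum_mem _ fun i hi => Submodule.smul_mem _ _ (Submodule.subset_span ?_)
    exact ⟨⟨i, Finset.mem_range.1 hi⟩, rfl⟩
  refine ⟨Module.Basis.mk hli hsp, fun i => ?_⟩
  rw [Module.Basis.mk_apply]
  change ι (t ^ (i : ℕ)) = _
  rw [map_pow, hιt]

theorem exists_int_mul_eq_aeval {f : ℤ[X]} (hm : f.Monic) {θ : ℂ} (hθ : aeval θ f = 0)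
    {z : ℂ} (hz : z ∈ ℚ⟮θ⟯) : ∃ k : ℕ, k ≠ 0 ∧ ∃ p : ℤ[X], (k : ℂ) * z = aeval θ p := by
  have halg : IsAlgebraic ℚ θ := by
    refine ⟨f.map (algebraMap ℤ ℚ), (hm.map _).ne_zero, ?_⟩
    rw [aeval_map_algebraMap, hθ]
  rw [← mem_toSubalgebra, adjoin_simple_toSubalgebra_of_isAlgebraic halg,
    Algebra.adjoin_singleton_eq_range_aeval] at hz
  obtain ⟨q, rfl⟩ := hz
  obtain ⟨b, hb, h⟩ := IsLocalization.integerNormalization_spec (nonZeroDivisors ℤ) q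
  have h1 := congrArg (aeval θ) h
  rw [aeval_map_algebraMap, zsmul_eq_mul, map_mul, map_intCast] at h1
  have hb0 : b ≠ 0 := nonZeroDivisors.ne_zero hb
  refine ⟨b.natAbs, Int.natAbs_ne_zero.2 hb0, ?_⟩
  change ∃ p : ℤ[X], (b.natAbs : ℂ) * aeval θ q = aeval θ p
  rcases Int.natAbs_eq b with h2 | h2
  · refine ⟨IsLocalization.integerNormalization (nonZeroDivisors ℤ) q, ?_⟩
    rw [h1, ← Int.cast_natCast, ← h2]
  · refine ⟨-IsLocalization.integerNormalization (nonZeroDivisors ℤ) q, ?_⟩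
    rw [map_neg, h1, ← Int.cast_natCast, ← neg_mul, ← Int.cast_neg, neg_eq_iff_eq_neg.2 h2]

/-- Some multiple k·z lies in ℤ[θ]; saturation removes the prime factors of k one at a time. -/
theorem exists_aeval_eq_of_saturated {f : ℤ[X]} (hm : f.Monic) {θ : ℂ} (hθ : aeval θ f = 0)
    (hsat : ∀ p : ℕ, p.Prime → ∀ h : ℤ[X], IsIntegral ℤ (aeval θ h / p : ℂ) →
      ∃ h' : ℤ[X], aeval θ h = (p : ℂ) * aeval θ h')
    {z : ℂ} (hzθ : z ∈ ℚ⟮θ⟯) (hz : IsIntegral ℤ z) : ∃ p : ℤ[X], aeval θ p = z := by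
  obtain ⟨k, hk, p, hp⟩ := exists_int_mul_eq_aeval hm hθ hzθ
  induction k using Nat.strong_induction_on generalizing p with
  | _ k ih =>
    by_cases h1 : k = 1
    · exact ⟨p, by rw [← hp, h1]; simp⟩
    obtain ⟨l, hl, m, rfl⟩ := Nat.exists_prime_and_dvd h1
    have hl0 : (l : ℂ) ≠ 0 := by exact_mod_cast hl.ne_zero
    have hm0 : m ≠ 0 := right_ne_zero_of_mul hk
    have hmz : aeval θ p / l = (m : ℂ) * z := by
      rw [← hp]; push_cast; field_simp
    obtain ⟨h', hh'⟩ := hsat l hl p (by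
      rw [hmz]; exact (isIntegral_algebraMap (R := ℤ) (x := (m : ℤ))).mul hz)
    refine ih m ?_ hm0 h' ?_
    · exact lt_mul_of_one_lt_left (Nat.pos_of_ne_zero hm0) hl.one_lt
    · rw [← hmz, hh']; field_simp

theorem map_zmod_eq_zero_iff {p : ℕ} {h : ℤ[X]} :
    h.map (Int.castRingHom (ZMod p)) = 0 ↔ ∃ h' : ℤ[X], h = C (p : ℤ) * h' := by
  have : (∃ h' : ℤ[X], h = C (p : ℤ) * h') ↔ C (p : ℤ) ∣ h := Iff.rfl
  rw [this, C_dvd_iff_dvd_coeff, Polynomial.ext_iff]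
  simp only [coeff_map, coeff_zero, eq_intCast, ZMod.intCast_zmod_eq_zero_iff_dvd]

theorem exists_aeval_of_map_dvd {f : ℤ[X]} {θ : ℂ} (hθ : aeval θ f = 0) {p : ℕ} {h : ℤ[X]}
    (hd : f.map (Int.castRingHom (ZMod p)) ∣ h.map (Int.castRingHom (ZMod p))) :
    ∃ h' : ℤ[X], aeval θ h = (p : ℂ) * aeval θ h' := by
  obtain ⟨g, hg⟩ := hd
  obtain ⟨G, rfl⟩ := Polynomial.map_surjective (Int.castRingHom (ZMod p))
    (ZMod.ringHom_surjective _) g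
  rw [← Polynomial.map_mul, ← sub_eq_zero, ← Polynomial.map_sub, map_zmod_eq_zero_iff] at hg
  obtain ⟨h', hh'⟩ := hg
  refine ⟨h', ?_⟩
  have := congrArg (aeval θ) hh'
  rw [map_sub, map_mul, hθ, map_mul, aeval_C] at this
  simpa using this

/-- If h(θ)/p is a root of the monic q, then h(θ) is a root of q with its roots scaled by p, which
reduces to a power of X modulo p. -/
theorem exists_map_dvd_pow {f : ℤ[X]} (hm : f.Monic) (hf : IrredOverQ f) {θ : ℂ}
    (hθ : aeval θ f = 0) {p : ℕ} (hp : p.Prime) {h : ℤ[X]}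
    (hz : IsIntegral ℤ (aeval θ h / p : ℂ)) :
    ∃ k : ℕ, f.map (Int.castRingHom (ZMod p)) ∣ h.map (Int.castRingHom (ZMod p)) ^ k := by
  have : Fact p.Prime := ⟨hp⟩
  obtain ⟨q, hq, hqz⟩ := hz
  have hp0 : (p : ℂ) ≠ 0 := by exact_mod_cast hp.ne_zero
  have h1 := scaleRoots_aeval_eq_zero (r := (p : ℤ)) (show aeval (aeval θ h / p : ℂ) q = 0 from hqz)
  have h2 : algebraMap ℤ ℂ p * (aeval θ h / p) = aeval θ h := by
    simp only [eq_intCast, Int.cast_natCast]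
    field_simp
  rw [h2, ← aeval_comp] at h1
  obtain ⟨g, hg⟩ := dvd_of_aeval_eq_zero hm hf hθ h1
  refine ⟨q.natDegree, g.map (Int.castRingHom (ZMod p)), ?_⟩
  rw [← Polynomial.map_mul, ← hg, map_comp, map_scaleRoots _ _ _ (by rw [hq]; simp)]
  have : (Int.castRingHom (ZMod p)) (p : ℤ) = 0 := by simp
  rw [this, scaleRoots_zero, (hq.map _).leadingCoeff, hq.natDegree_map]
  simp

/-- Modulo p the polynomial f is separable, hence squarefree, so f dividing a power of h already
divides h. -/
theorem saturated_of_separable {f : ℤ[X]} (hm : f.Monic) (hf : IrredOverQ f) {θ : ℂ}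
    (hθ : aeval θ f = 0) {M : ℤ} {u v : ℤ[X]} (huv : u * derivative f + v * f = C M) {p : ℕ}
    (hp : p.Prime) (hpM : ¬ (p : ℤ) ∣ M) (h : ℤ[X]) (hz : IsIntegral ℤ (aeval θ h / p : ℂ)) :
    ∃ h' : ℤ[X], aeval θ h = (p : ℂ) * aeval θ h' := by
  have : Fact p.Prime := ⟨hp⟩
  obtain ⟨k, hk⟩ := exists_map_dvd_pow hm hf hθ hp hz
  refine exists_aeval_of_map_dvd hθ (Squarefree.isRadical (Separable.squarefree ?_) k _ hk)
  set φ := Int.castRingHom (ZMod p)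
  have hM : φ M ≠ 0 := by
    simp only [φ, eq_intCast, ne_eq, ZMod.intCast_zmod_eq_zero_iff_dvd]; exact hpM
  have h1 := congrArg (Polynomial.map φ) huv
  rw [Polynomial.map_add, Polynomial.map_mul, Polynomial.map_mul, map_C, ← derivative_map] at h1
  refine ⟨C (φ M)⁻¹ * v.map φ, C (φ M)⁻¹ * u.map φ, ?_⟩
  have h2 : C (φ M)⁻¹ * C (φ M) = (1 : (ZMod p)[X]) := by
    rw [← C_mul, inv_mul_cancel₀ hM, C_1]
  linear_combination C (φ M)⁻¹ * h1 + h2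

/-- The gcd of h and φ^(e+1) is associated to some φ^i, and i ≤ e. -/
theorem exists_bezout_pow_pred {F : Type*} [Field F] {φ h : F[X]} (hφ : Irreducible φ) {e : ℕ}
    (hnd : ¬ φ ^ (e + 1) ∣ h) : ∃ u v : F[X], u * h + v * φ ^ (e + 1) = φ ^ e := by
  classical
  obtain ⟨i, hi, hass⟩ := (_root_.dvd_prime_pow hφ.prime (e + 1)).1
    (EuclideanDomain.gcd_dvd_right h (φ ^ (e + 1)))
  have hie : i ≤ e := by
    by_contra hlt
    obtain rfl : i = e + 1 := by omega
    exact hnd (hass.symm.dvd.trans (EuclideanDomain.gcd_dvd_left _ _))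
  obtain ⟨w, hw⟩ := hass.dvd.trans (pow_dvd_pow φ hie)
  have hb := EuclideanDomain.gcd_eq_gcd_ab h (φ ^ (e + 1))
  refine ⟨w * EuclideanDomain.gcdA h (φ ^ (e + 1)), w * EuclideanDomain.gcdB h (φ ^ (e + 1)), ?_⟩
  rw [hw]
  linear_combination -w * hb

theorem not_isIntegral_inv_prime {p : ℕ} (hp : p.Prime) : ¬ IsIntegral ℤ ((p : ℂ)⁻¹) := by
  intro h
  have h1 : IsIntegral ℤ ((p : ℚ)⁻¹) := by
    rw [← isIntegral_algebraMap_iff (algebraMap ℚ ℂ).injective]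
    simpa using h
  obtain ⟨y, hy⟩ := IsIntegrallyClosed.isIntegral_iff.1 h1
  have hp0 : (p : ℚ) ≠ 0 := by exact_mod_cast hp.ne_zero
  have h2 : (y * p : ℤ) = 1 := by
    have : (y * p : ℚ) = 1 := by
      have hy' : (y : ℚ) = (p : ℚ)⁻¹ := hy
      rw [hy', inv_mul_cancel₀ hp0]
    exact_mod_cast this
  have h3 : (p : ℤ) ∣ 1 := ⟨y, by rw [← h2, mul_comm]⟩
  exact hp.one_lt.ne' (by exact_mod_cast Int.eq_one_of_dvd_one (by positivity) h3)

/-- Dedekind's criterion at a prime where f is a power of one irreducible φ. If h is not divisible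
by f modulo p, a Bezout relation gives φ(θ)^e = pζ with ζ integral. Then f(θ) = 0 yields r(θ) =
-ζφ(θ), and coprimality of r and φ makes 1 - p·w(θ) a multiple of φ(θ). Its power of exponent e+1 is
a multiple of φ(θ)^(e+1) = -p·r(θ), so 1/p would be integral. -/
theorem saturated_of_eisenstein {f : ℤ[X]} (hm : f.Monic) {θ : ℂ}
    (hθ : aeval θ f = 0) {p : ℕ} (hp : p.Prime) {φ r : ℤ[X]} {e : ℕ}
    (hfe : f = φ ^ (e + 1) + C (p : ℤ) * r)
    (hφ : Irreducible (φ.map (Int.castRingHom (ZMod p)))) {u v w : ℤ[X]}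
    (hbez : u * r + v * φ + C (p : ℤ) * w = 1)
    (h : ℤ[X]) (hz : IsIntegral ℤ (aeval θ h / p : ℂ)) :
    ∃ h' : ℤ[X], aeval θ h = (p : ℂ) * aeval θ h' := by
  have : Fact p.Prime := ⟨hp⟩
  by_cases hdvd : f.map (Int.castRingHom (ZMod p)) ∣ h.map (Int.castRingHom (ZMod p))
  · exact exists_aeval_of_map_dvd hθ hdvd
  exfalso
  have hfm : f.map (Int.castRingHom (ZMod p)) = (φ.map (Int.castRingHom (ZMod p))) ^ (e + 1) := by
    rw [hfe]; simp
  rw [hfm] at hdvd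
  obtain ⟨U', V', hUV⟩ := exists_bezout_pow_pred hφ hdvd
  have hsurj := Polynomial.map_surjective (Int.castRingHom (ZMod p)) (ZMod.ringHom_surjective _)
  obtain ⟨U, rfl⟩ := hsurj U'
  obtain ⟨V, rfl⟩ := hsurj V'
  rw [← Polynomial.map_mul, ← Polynomial.map_pow, ← Polynomial.map_pow, ← Polynomial.map_mul,
    ← Polynomial.map_add, ← sub_eq_zero, ← Polynomial.map_sub, map_zmod_eq_zero_iff] at hUV
  obtain ⟨W, hW⟩ := hUV
  have hp0 : (p : ℂ) ≠ 0 := by exact_mod_cast hp.ne_zero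
  set z : ℂ := aeval θ h / p
  have hh : aeval θ h = p * z := by simp only [z]; field_simp
  have hpoly : ∀ q : ℤ[X], aeval θ q ∈ integralClosure ℤ ℂ := fun q =>
    Algebra.adjoin_le (Set.singleton_subset_iff.2 (⟨f, hm, hθ⟩ : IsIntegral ℤ θ))
      (aeval_mem_adjoin_singleton ℤ θ)
  have e1 := congrArg (aeval θ) hW
  have e2 := congrArg (aeval θ) hfe
  have e3 := congrArg (aeval θ) hbez
  simp only [map_sub, map_add, map_mul, map_pow, map_one, hθ, hh, map_natCast] at e1 e2 e3
  set ζ : ℂ := aeval θ U * z - aeval θ V * aeval θ r - aeval θ W with hζ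
  have hζi : ζ ∈ integralClosure ℤ ℂ :=
    sub_mem (sub_mem (mul_mem (hpoly U) hz) (mul_mem (hpoly V) (hpoly r))) (hpoly W)
  have e4 : aeval θ φ ^ e = p * ζ := by
    rw [hζ]; linear_combination -e1 - aeval θ V * e2
  have e5 : aeval θ r = -(ζ * aeval θ φ) := by
    refine mul_left_cancel₀ hp0 ?_
    linear_combination -e2 - aeval θ φ * e4
  set η : ℂ := aeval θ v - aeval θ u * ζ with hη
  have hηi : η ∈ integralClosure ℤ ℂ := sub_mem (hpoly v) (mul_mem (hpoly u) hζi)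
  have e6 : 1 - (p : ℂ) * aeval θ w = aeval θ φ * η := by
    rw [hη]; linear_combination -e3 + aeval θ u * e5
  obtain ⟨s, hs⟩ := sub_dvd_pow_sub_pow (1 : integralClosure ℤ ℂ)
    (1 - (p : integralClosure ℤ ℂ) * ⟨aeval θ w, hpoly w⟩) (e + 1)
  have hs' := congrArg (algebraMap (integralClosure ℤ ℂ) ℂ) hs
  have e7 : (1 : ℂ) - (1 - p * aeval θ w) ^ (e + 1) = p * aeval θ w * s := by
    simp only [one_pow, map_sub, map_one, map_pow, map_mul, map_natCast, sub_sub_cancel] at hs'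
    exact hs'
  rw [e6, mul_pow] at e7
  refine not_isIntegral_inv_prime hp ?_
  have e8 : (p : ℂ)⁻¹ = aeval θ w * s - aeval θ r * η ^ (e + 1) := by
    field_simp
    linear_combination e7 - η ^ (e + 1) * e2
  rw [e8]
  exact sub_mem (mul_mem (hpoly w) s.2) (mul_mem (hpoly r) (pow_mem hηi _))

/-! ### Explicit conjugates in the three families -/

section Roots
variable {K : Type*} [Field K] {a b D θ ω : K}

/-- With s = θ³ + aθ, dividing x³ + ax - s by x - θ leaves x² + θx + θ² + a, of discriminant -3θ² -
4a. The cubic has discriminant (D/s)², which suggests ω = D/(s(3θ² + a)). The quartic factor arises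
because its product with 3θ² + a is 4a³ - 27b. -/
theorem family1_quadratic (hD0 : D ≠ 0) (hD : D ^ 2 = 4 * a ^ 3 * b - 27 * b ^ 2)
    (hθ : θ ^ 2 * (θ ^ 2 + a) ^ 2 + b = 0)
    (hω : D * ω = -(θ ^ 3 + a * θ) * (9 * θ ^ 4 + 15 * a * θ ^ 2 + 4 * a ^ 2)) :
    ω ^ 2 = -3 * θ ^ 2 - 4 * a := by
  have hQ : (9 * θ ^ 4 + 15 * a * θ ^ 2 + 4 * a ^ 2) ^ 2 =
      (4 * a ^ 3 - 27 * b) * (3 * θ ^ 2 + 4 * a) := by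
    linear_combination (81 * θ ^ 2 + 108 * a) * hθ
  refine mul_left_cancel₀ (pow_ne_zero 2 hD0) ?_
  have h1 : D ^ 2 * ω ^ 2 = (θ ^ 3 + a * θ) ^ 2 * (9 * θ ^ 4 + 15 * a * θ ^ 2 + 4 * a ^ 2) ^ 2 := by
    rw [← mul_pow, hω]; ring
  rw [h1, hQ]
  linear_combination (4 * a ^ 3 - 27 * b) * (3 * θ ^ 2 + 4 * a) * hθ +
    (3 * θ ^ 2 + 4 * a) * hD

theorem family1_root [CharZero K] (hθ : θ ^ 2 * (θ ^ 2 + a) ^ 2 + b = 0)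
    (hω : ω ^ 2 = -3 * θ ^ 2 - 4 * a) :
    ((-θ + ω) / 2) ^ 2 * (((-θ + ω) / 2) ^ 2 + a) ^ 2 + b = 0 := by
  have h : ((-θ + ω) / 2) ^ 3 + a * ((-θ + ω) / 2) = θ ^ 3 + a * θ := by
    linear_combination ((ω - 3 * θ) / 8) * hω
  linear_combination (((-θ + ω) / 2) ^ 3 + a * ((-θ + ω) / 2) + θ ^ 3 + a * θ) * h + hθ

variable {s : K}

/-- Here s is θ³/(bθ² + 1) rewritten as a polynomial in θ, so that f = (x³ - s(bx² + 1))(x³ + s(bx²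
+ 1)). -/
theorem family2_sq (hθ : θ ^ 6 + a * (b * θ ^ 2 + 1) ^ 2 = 0)
    (hs : s = -b * θ ^ 5 + (1 - a * b ^ 3) * θ ^ 3 - a * b ^ 2 * θ) : s ^ 2 = -a := by
  rw [hs]
  linear_combination (θ ^ 4 * b ^ 2 + θ ^ 2 * a * b ^ 4 - 2 * θ ^ 2 * b + 1) * hθ

theorem family2_cube (hθ : θ ^ 6 + a * (b * θ ^ 2 + 1) ^ 2 = 0)
    (hs : s = -b * θ ^ 5 + (1 - a * b ^ 3) * θ ^ 3 - a * b ^ 2 * θ) :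
    θ ^ 3 = s * (b * θ ^ 2 + 1) := by
  rw [hs]
  linear_combination θ * b ^ 2 * hθ

/-- The right-hand side is the discriminant of x² + (θ - sb)x + θ(θ - sb), the cofactor of x - θ in
x³ - s(bx² + 1). -/
theorem family2_quadratic (hD0 : D ≠ 0) (hD : D ^ 2 = 4 * a * b ^ 3 - 27)
    (hθ : θ ^ 6 + a * (b * θ ^ 2 + 1) ^ 2 = 0)
    (hs : s = -b * θ ^ 5 + (1 - a * b ^ 3) * θ ^ 3 - a * b ^ 2 * θ)
    (hω : D * ω = -b ^ 2 * θ ^ 5 + (3 * b - a * b ^ 4) * θ ^ 3 + (a * b ^ 3 - 9) * θ) :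
    ω ^ 2 = (θ - s * b) ^ 2 - 4 * θ * (θ - s * b) := by
  refine mul_left_cancel₀ (pow_ne_zero 2 hD0) ?_
  rw [← mul_pow, hω, hD, hs]
  linear_combination (-4 * θ ^ 4 * a * b ^ 7 + 28 * θ ^ 4 * b ^ 4 - 4 * θ ^ 2 * a ^ 2 * b ^ 9 +
    36 * θ ^ 2 * a * b ^ 6 - 60 * θ ^ 2 * b ^ 3) * hθ

theorem family2_root [CharZero K] (hs2 : s ^ 2 = -a) (hs3 : θ ^ 3 = s * (b * θ ^ 2 + 1))
    (hω : ω ^ 2 = (θ - s * b) ^ 2 - 4 * θ * (θ - s * b)) :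
    ((s * b - θ + ω) / 2) ^ 6 + a * (b * ((s * b - θ + ω) / 2) ^ 2 + 1) ^ 2 = 0 := by
  set β := (s * b - θ + ω) / 2 with hβ
  have h1 : β ^ 2 + (θ - s * b) * β + θ * (θ - s * b) = 0 := by
    rw [hβ]; linear_combination hω / 4
  have h : β ^ 3 = s * (b * β ^ 2 + 1) := by
    linear_combination (β - θ) * h1 + hs3
  linear_combination (β ^ 3 + s * (b * β ^ 2 + 1)) * h + (b * β ^ 2 + 1) ^ 2 * hs2

variable {N w : K}

/-- Substituting w² = -θ² makes the simplest cubic w³ - aw² - (a+3)w - 1 linear in w, with solution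
w = (aθ² - 1)/(θ² + a + 3). Clearing the denominator modulo the sextic gives the expression for Nw.
-/
theorem family3_sq (hN0 : N ≠ 0)
    (hθ : θ ^ 6 + (a ^ 2 + 2 * a + 6) * θ ^ 4 + (a ^ 2 + 4 * a + 9) * θ ^ 2 + 1 = 0)
    (hN : N = a ^ 2 + 3 * a + 1) (hw : N * w = θ ^ 4 + (a ^ 2 + a + 3) * θ ^ 2 - a) :
    w ^ 2 = -θ ^ 2 := by
  refine mul_left_cancel₀ (pow_ne_zero 2 hN0) ?_
  rw [← mul_pow, hw, hN]
  linear_combination (θ ^ 2 + a ^ 2) * hθ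

theorem family3_cubic (hN0 : N ≠ 0)
    (hθ : θ ^ 6 + (a ^ 2 + 2 * a + 6) * θ ^ 4 + (a ^ 2 + 4 * a + 9) * θ ^ 2 + 1 = 0)
    (hN : N = a ^ 2 + 3 * a + 1) (hw : N * w = θ ^ 4 + (a ^ 2 + a + 3) * θ ^ 2 - a) :
    w ^ 3 - a * w ^ 2 - (a + 3) * w - 1 = 0 := by
  have hw2 := family3_sq hN0 hθ hN hw
  refine mul_left_cancel₀ hN0 ?_
  linear_combination (w * N - a * N) * hw2 + (-θ ^ 2 - (a + 3)) * hw - hθ + (a * θ ^ 2 - 1) * hN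

/-- The substitution w ↦ w' carries roots of the simplest cubic g to roots. At x² = -y² the sextic
takes the value g(y)g(-y). -/
theorem family3_root {w' : K} (hw : w ^ 3 - a * w ^ 2 - (a + 3) * w - 1 = 0)
    (hw' : w' = w ^ 2 - (a + 1) * w - 2) {β : K} (hβ : β ^ 2 = -w' ^ 2) :
    β ^ 6 + (a ^ 2 + 2 * a + 6) * β ^ 4 + (a ^ 2 + 4 * a + 9) * β ^ 2 + 1 = 0 := by
  have h : w' ^ 3 - a * w' ^ 2 - (a + 3) * w' - 1 = 0 := by
    rw [hw']
    linear_combination (a ^ 2 * w - 2 * a * w ^ 2 + 3 * a * w + 2 * a + w ^ 3 - 3 * w ^ 2 + 3) * hw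
  have e : β ^ 6 + (a ^ 2 + 2 * a + 6) * β ^ 4 + (a ^ 2 + 4 * a + 9) * β ^ 2 + 1 =
      (β ^ 2) ^ 3 + (a ^ 2 + 2 * a + 6) * (β ^ 2) ^ 2 + (a ^ 2 + 4 * a + 9) * β ^ 2 + 1 := by ring
  rw [e, hβ]
  linear_combination -(w' ^ 3 + a * w' ^ 2 - (a + 3) * w' + 1) * h

end Roots

/-! ### The three families have group C_6 -/

theorem aeval_poly1 {R : Type*} [CommRing R] (a b : ℤ) (x : R) :
    aeval x (poly1 a b) = x ^ 2 * (x ^ 2 + a) ^ 2 + b := by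
  simp [poly1]

theorem aeval_poly2 {R : Type*} [CommRing R] (a b : ℤ) (x : R) :
    aeval x (poly2 a b) = x ^ 6 + a * (b * x ^ 2 + 1) ^ 2 := by
  simp [poly2]

theorem poly3_eq (n : ℤ) : poly3 n =
    evenSextic ((n - 1) ^ 2 + 2 * (n - 1) + 6) ((n - 1) ^ 2 + 4 * (n - 1) + 9) 1 := by
  rw [poly3]; congr 1 <;> ring

/-- If D = 0 then 4a³ = 27b, and 27f factors as (3x² + a)²(3x² + 4a), contradicting irreducibility.
-/
theorem poly1_disc_ne_zero {a b D : ℤ} (hf : IrredOverQ (poly1 a b))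
    (hD : 4 * a ^ 3 * b - 27 * b ^ 2 = D * D) : D ≠ 0 := by
  rintro rfl
  rw [poly1_eq] at hf
  have hb := const_ne_zero hf
  obtain ⟨θ, hθ⟩ := exists_complex_root (2 * a) (a ^ 2) b
  have h1 : 4 * a ^ 3 = 27 * b := mul_right_cancel₀ hb (by linear_combination hD)
  have h2 : 4 * (a : ℂ) ^ 3 = 27 * b := by exact_mod_cast h1
  have h3 := hθ
  rw [aeval_evenSextic] at h3
  push_cast at h3
  have h4 : (3 * θ ^ 2 + a) ^ 2 * (3 * θ ^ 2 + 4 * a) = 0 := by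
    linear_combination 27 * h3 + h2
  rcases mul_eq_zero.1 h4 with h | h
  · have := sq_coeffs hf hθ (q0 := a) (q1 := 3) (q2 := 0)
      (by push_cast; linear_combination pow_eq_zero_iff two_ne_zero |>.1 h)
    norm_num at this
  · have := sq_coeffs hf hθ (q0 := 4 * a) (q1 := 3) (q2 := 0)
      (by push_cast; linear_combination h)
    norm_num at this

theorem galIsoC6_poly1 {a b : ℤ} (hf : IrredOverQ (poly1 a b))
    (hsq : IsSquare (4 * a ^ 3 * b - 27 * b ^ 2)) : GalIsoC6 (poly1 a b) := by
  obtain ⟨D, hD⟩ := hsq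
  have hD0 := poly1_disc_ne_zero hf hD
  rw [poly1_eq] at hf ⊢
  -- This is β/θ for the conjugate β = (-θ + ω)/2, written as a polynomial in θ².
  refine galIsoC6_of_root hf (C (-1 / 2 : ℚ) - C (1 / (2 * D) : ℚ) * (X + C (a : ℚ)) *
    (C 9 * X ^ 2 + C (15 * a : ℚ) * X + C (4 * a ^ 2 : ℚ))) fun K _ _ θ hθ => ?_
  have : CharZero K := algebraRat.charZero K
  have hD0' : (D : K) ≠ 0 := by exact_mod_cast hD0
  have hD' : (D : K) ^ 2 = 4 * (a : K) ^ 3 * b - 27 * (b : K) ^ 2 := by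
    have : D ^ 2 = 4 * a ^ 3 * b - 27 * b ^ 2 := by rw [hD]; ring
    exact_mod_cast this
  have hθ' : θ ^ 2 * (θ ^ 2 + a) ^ 2 + b = 0 := by
    rw [← poly1_eq, aeval_poly1] at hθ; exact hθ
  set v : K := aeval (θ ^ 2) (C (-1 / 2 : ℚ) - C (1 / (2 * D) : ℚ) * (X + C (a : ℚ)) *
    (C 9 * X ^ 2 + C (15 * a : ℚ) * X + C (4 * a ^ 2 : ℚ))) with hv
  have hv' : v = -1 / 2 - 1 / (2 * D) * (θ ^ 2 + a) *
      (9 * (θ ^ 2) ^ 2 + 15 * a * θ ^ 2 + 4 * a ^ 2) := by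
    rw [hv]; simp
  set ω : K := 2 * (θ * v) + θ with hω
  have hDω : D * ω = -(θ ^ 3 + a * θ) * (9 * θ ^ 4 + 15 * a * θ ^ 2 + 4 * a ^ 2) := by
    rw [hω, hv']; field_simp; ring
  have hq := family1_quadratic hD0' hD' hθ' hDω
  have hβ : θ * v = (-θ + ω) / 2 := by rw [hω]; ring
  refine ⟨?_, fun h => ?_⟩
  · rw [← poly1_eq, aeval_poly1, hβ]
    exact family1_root hθ' hq
  · have hpoly : (θ * v) ^ 2 + θ * (θ * v) + θ ^ 2 + a = 0 := by
      rw [hβ]; linear_combination hq / 4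
    -- With v = ±1 the quadratic equation for θv becomes a nontrivial linear relation between 1 and
    -- θ².
    rcases mul_self_eq_one_iff.1 ((sq v).symm.trans h) with h1 | h1
    · rw [h1] at hpoly
      have := sq_coeffs hf hθ (q0 := a) (q1 := 3) (q2 := 0)
        (by push_cast; linear_combination hpoly)
      norm_num at this
    · rw [h1] at hpoly
      have := sq_coeffs hf hθ (q0 := a) (q1 := 1) (q2 := 0)
        (by push_cast; linear_combination hpoly)
      norm_num at this

theorem galIsoC6_poly2 {a b : ℤ} (hf : IrredOverQ (poly2 a b))
    (hsq : IsSquare (4 * a * b ^ 3 - 27)) : GalIsoC6 (poly2 a b) := by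
  obtain ⟨D, hD⟩ := hsq
  have hD0 : D ≠ 0 := by 
    rintro rfl
    have : 4 * (a * b ^ 3) = 27 := by linear_combination hD
    omega
  rw [poly2_eq] at hf ⊢
  -- Again β/θ as a polynomial in θ², now with β = (sb - θ + ω)/2.
  refine galIsoC6_of_root hf (C (1 / 2 : ℚ) *
    (C (b : ℚ) * (C (-b : ℚ) * X ^ 2 + C (1 - a * b ^ 3 : ℚ) * X - C (a * b ^ 2 : ℚ)) - 1 +
      C (1 / D : ℚ) * (C (-b ^ 2 : ℚ) * X ^ 2 + C (3 * b - a * b ^ 4 : ℚ) * X +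
        C (a * b ^ 3 - 9 : ℚ)))) fun K _ _ θ hθ => ?_
  have : CharZero K := algebraRat.charZero K
  have hD0' : (D : K) ≠ 0 := by exact_mod_cast hD0
  have hD' : (D : K) ^ 2 = 4 * (a : K) * b ^ 3 - 27 := by
    have : D ^ 2 = 4 * a * b ^ 3 - 27 := by rw [hD]; ring
    exact_mod_cast this
  have hθ' : θ ^ 6 + a * (b * θ ^ 2 + 1) ^ 2 = 0 := by
    have := hθ
    rwa [← poly2_eq, aeval_poly2] at this
  obtain ⟨s, hs⟩ : ∃ s : K, s = -b * θ ^ 5 + (1 - a * b ^ 3) * θ ^ 3 - a * b ^ 2 * θ := ⟨_, rfl⟩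
  rw [← poly2_eq, aeval_poly2]
  simp only [map_mul, map_add, map_sub, map_pow, aeval_C, aeval_X, map_one, eq_ratCast,
    map_neg]
  push_cast
  set v : K := 1 / 2 * (b * (-b * (θ ^ 2) ^ 2 + (1 - a * b ^ 3) * θ ^ 2 - a * b ^ 2) - 1 +
    1 / D * (-b ^ 2 * (θ ^ 2) ^ 2 + (3 * b - a * b ^ 4) * θ ^ 2 + (a * b ^ 3 - 9))) with hv
  set ω : K := 2 * (θ * v) - s * b + θ with hω
  have hDω : D * ω = -b ^ 2 * θ ^ 5 + (3 * b - a * b ^ 4) * θ ^ 3 + (a * b ^ 3 - 9) * θ := by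
    rw [hω, hv, hs]; field_simp; ring
  have hq := family2_quadratic hD0' hD' hθ' hs hDω
  have hβ : θ * v = (s * b - θ + ω) / 2 := by rw [hω]; ring
  refine ⟨?_, fun h => ?_⟩
  · rw [hβ]
    exact family2_root (family2_sq hθ' hs) (family2_cube hθ' hs) hq
  · have hpoly : (θ * v) ^ 2 + (θ - s * b) * (θ * v) + θ * (θ - s * b) = 0 := by
      rw [hβ]; linear_combination hq / 4
    have hθ0 := pow_ne_zero 2 (root_ne_zero hf hθ)
    rcases mul_self_eq_one_iff.1 ((sq v).symm.trans h) with h1 | h1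
    · rw [h1, hs] at hpoly
      have h2 : (3 + 2 * a * b ^ 3 : K) + (-2 * b * (1 - a * b ^ 3)) * θ ^ 2 +
          2 * b ^ 2 * (θ ^ 2) ^ 2 = 0 := mul_left_cancel₀ hθ0 (by linear_combination hpoly)
      obtain ⟨h3, -, h4⟩ := sq_coeffs hf hθ (q0 := 3 + 2 * a * b ^ 3)
        (q1 := -2 * b * (1 - a * b ^ 3)) (q2 := 2 * b ^ 2) (by push_cast; exact h2)
      have hb : (b : ℚ) = 0 := by simpa using h4
      rw [hb] at h3
      norm_num at h3
    · rw [h1] at hpoly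
      exact hθ0 (by linear_combination hpoly)

theorem family3_index_ne_zero (n : ℤ) : (n - 1) ^ 2 + 3 * (n - 1) + 1 ≠ 0 := by
  intro h
  have : n * (n + 1) = 1 := by linear_combination h
  rcases Int.mul_eq_one_iff_eq_one_or_neg_one.1 this with h | h <;> omega

theorem irredOverQ_poly3 (n : ℤ) : IrredOverQ (poly3 n) := by
  refine irredOverQ_of_const_one ?_ ?_
  · nlinarith [sq_nonneg n, sq_nonneg (n + 1)]
  · intro h
    have : 2 * n + 1 = 0 := by linear_combination -h
    omega

theorem galIsoC6_poly3 (n : ℤ) : GalIsoC6 (poly3 n) := by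
  have hf := irredOverQ_poly3 n
  rw [poly3_eq] at hf ⊢
  obtain ⟨α, hα⟩ : ∃ α, α = n - 1 := ⟨_, rfl⟩
  have hN0 := family3_index_ne_zero n
  rw [← hα] at hf hN0 ⊢
  obtain ⟨N, hN⟩ : ∃ N, N = α ^ 2 + 3 * α + 1 := ⟨_, rfl⟩
  rw [← hN] at hN0
  set W : ℚ[X] := C (1 / N : ℚ) * (X ^ 2 + C (α ^ 2 + α + 3 : ℚ) * X - C (α : ℚ)) with hW
  -- The second factor is w⁻¹ by the cubic equation, so the product is w'/w and the new root is
  -- θw'/w.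
  refine galIsoC6_of_root hf
    ((W ^ 2 - C (α + 1 : ℚ) * W - 2) * (W ^ 2 - C (α : ℚ) * W - C (α + 3 : ℚ)))
    fun K _ _ θ hθ => ?_
  have : CharZero K := algebraRat.charZero K
  have hN0' : (N : K) ≠ 0 := by exact_mod_cast hN0
  have hN' : (N : K) = (α : K) ^ 2 + 3 * α + 1 := by exact_mod_cast hN
  have hθ' : θ ^ 6 + ((α : K) ^ 2 + 2 * α + 6) * θ ^ 4 + ((α : K) ^ 2 + 4 * α + 9) * θ ^ 2 +
      1 = 0 := by
    have := hθ
    rw [aeval_evenSextic] at this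
    exact_mod_cast this
  set w : K := aeval (θ ^ 2) W with hw
  have hNw : N * w = θ ^ 4 + ((α : K) ^ 2 + α + 3) * θ ^ 2 - α := by
    rw [hw, hW]
    simp
    field_simp
  have hw2 := family3_sq hN0' hθ' hN' hNw
  have hw3 := family3_cubic hN0' hθ' hN' hNw
  rw [aeval_evenSextic]
  simp only [map_mul, map_sub, map_pow, aeval_C, ← hw, eq_ratCast, map_ofNat]
  push_cast
  obtain ⟨w', hw'⟩ : ∃ w' : K, w' = w ^ 2 - (α + 1) * w - 2 := ⟨_, rfl⟩
  have hinv : w * (w ^ 2 - α * w - (α + 3)) = 1 := by linear_combination hw3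
  rw [← hw']
  constructor
  · refine family3_root hw3 hw' ?_
    linear_combination w' ^ 2 * (w ^ 2 - α * w - (α + 3)) ^ 2 * hw2 -
      w' ^ 2 * (w * (w ^ 2 - α * w - (α + 3)) + 1) * hinv
  · intro h
    have h1 : w' ^ 2 = w ^ 2 := by
      linear_combination w ^ 2 * h - w' ^ 2 * (w * (w ^ 2 - α * w - (α + 3)) + 1) * hinv
    have h2 : ∃ ε : ℚ, w' = ε * w := by
      rcases sq_eq_sq_iff_eq_or_eq_neg.1 h1 with h | h
      · exact ⟨1, by simp [h]⟩
      · exact ⟨-1, by simp [h]⟩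
    obtain ⟨ε, hε⟩ := h2
    -- Squaring this and using w² = -θ² gives a relation of degree 4 in θ, which irreducibility
    -- forbids.
    have h3 : w * (α + 1 + ε) = -θ ^ 2 - 2 := by linear_combination hw2 - hε + hw'
    have := sq_coeffs hf hθ (q0 := 4) (q1 := 4 + (α + 1 + ε) ^ 2) (q2 := 1) (by
      push_cast
      linear_combination -(w * (α + 1 + ε) - θ ^ 2 - 2) * h3 + (α + 1 + ε) ^ 2 * hw2)
    norm_num at this

/-! ### Which members of the families can be monogenic -/

theorem isIntegral_of_quadratic {R : Type*} [CommRing R] {z : R} {m k : ℤ}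
    (h : z ^ 2 + m * z + k = 0) : IsIntegral ℤ z := by
  refine ⟨X ^ 2 + C m * X + C k, by monicity!, ?_⟩
  change aeval z _ = 0
  simpa using h

theorem isIntegral_of_evenSextic {R : Type*} [CommRing R] {z : R} {a b c : ℤ}
    (h : aeval z (evenSextic a b c) = 0) : IsIntegral ℤ z :=
  ⟨_, evenSextic_monic a b c, h⟩

theorem family1_solutions_of_pos {a b d : ℤ} (hb : b ≠ 0) (hb4 : b % 4 ≠ 3) (hd : 0 < d)
    (h : 4 * a ^ 3 = b * (27 + d ^ 2)) (h1 : b * d ∣ 3 * a) (h2 : d ∣ 18) :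
    (a = -3 ∧ b = -3) ∨ (a = 3 ∧ b = 1) := by
  obtain ⟨k, hk⟩ := h1
  -- Inserting 3a = bdk into 27·4a³ eliminates a. As d divides 18, only finitely many (b, k) remain.
  have ht : 4 * d ^ 3 * (b ^ 2 * k ^ 3) = 27 * (27 + d ^ 2) := by
    refine mul_left_cancel₀ hb ?_
    have : 27 * (4 * a ^ 3) = 4 * (3 * a) ^ 3 := by ring
    rw [h, hk] at this
    linear_combination -this
  have hd18 : d ≤ 18 := Int.le_of_dvd (by norm_num) h2
  have hb2 : 1 ≤ b ^ 2 := by have := sq_pos_of_ne_zero hb; omega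
  have hkpos : 0 < k := by
    by_contra hk0
    have h3 : k ^ 3 ≤ 0 := by
      have : k ^ 3 = k * k ^ 2 := by ring
      rw [this]
      exact mul_nonpos_of_nonpos_of_nonneg (by omega) (sq_nonneg k)
    have h4 : 4 * d ^ 3 * (b ^ 2 * k ^ 3) ≤ 0 :=
      mul_nonpos_of_nonneg_of_nonpos (by positivity)
        (mul_nonpos_of_nonneg_of_nonpos (by positivity) h3)
    nlinarith [sq_nonneg d]
  have bound : ∀ M : ℤ, b ^ 2 * k ^ 3 = M → k ^ 3 ≤ M ∧ b ^ 2 ≤ M := fun M hM => by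
    have hk3 : 1 ≤ k ^ 3 := by have := pow_pos hkpos 3; omega
    constructor <;> nlinarith
  have hcases : d = 1 ∨ d = 3 ∨ d = 9 := by
    interval_cases d <;> omega
  rcases hcases with rfl | rfl | rfl
  · have hM : b ^ 2 * k ^ 3 = 189 := by omega
    obtain ⟨hk3, hbM⟩ := bound _ hM
    have hk5 : k ≤ 5 := by nlinarith [sq_nonneg k]
    have hb1 : b ≤ 13 := by nlinarith
    have hb2 : -13 ≤ b := by nlinarith
    exfalso
    interval_cases k <;> interval_cases b <;> omega
  · have hM : b ^ 2 * k ^ 3 = 9 := by omega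
    obtain ⟨hk3, hbM⟩ := bound _ hM
    have hk5 : k ≤ 2 := by nlinarith [sq_nonneg k]
    have hb1 : b ≤ 3 := by nlinarith
    have hb2 : -3 ≤ b := by nlinarith
    interval_cases k <;> interval_cases b <;> omega
  · have hM : b ^ 2 * k ^ 3 = 1 := by omega
    obtain ⟨hk3, hbM⟩ := bound _ hM
    have hk5 : k ≤ 1 := by nlinarith [sq_nonneg k]
    have hb1 : b ≤ 1 := by nlinarith
    have hb2 : -1 ≤ b := by nlinarith
    interval_cases k; interval_cases b <;> omega

theorem family1_solutions {a b D : ℤ} (hb : b ≠ 0) (hb4 : b % 4 ≠ 3) (hsf : Squarefree b)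
    (hD0 : D ≠ 0) (hD : 4 * a ^ 3 * b - 27 * b ^ 2 = D * D) (h1 : 2 * D ∣ 6 * a)
    (h2 : 2 * D ∣ 4 * a ^ 3 - 9 * b + D) : (a = -3 ∧ b = -3) ∨ (a = 3 ∧ b = 1) := by
  -- D² is a multiple of the squarefree b.
  obtain ⟨d, rfl⟩ : b ∣ D := (hsf.dvd_pow_iff_dvd two_ne_zero).1
    ⟨4 * a ^ 3 - 27 * b, by linear_combination -hD⟩
  have h : 4 * a ^ 3 = b * (27 + d ^ 2) := mul_left_cancel₀ hb (by linear_combination hD)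
  have h3 : b * d ∣ 3 * a := by
    obtain ⟨k, hk⟩ := h1
    exact ⟨k, by linarith⟩
  have h4 : d ∣ 18 := by
    obtain ⟨k, hk⟩ := h2
    have : 2 * d * k = 18 + d ^ 2 + d := mul_left_cancel₀ hb (by linear_combination -hk + h)
    exact ⟨2 * k - d - 1, by linear_combination -this⟩
  have hd0 : d ≠ 0 := right_ne_zero_of_mul hD0
  rcases lt_or_gt_of_ne hd0 with hneg | hpos
  · refine family1_solutions_of_pos (d := -d) hb hb4 (by omega) (by rw [h]; ring) ?_ ?_
    · rw [mul_neg, neg_dvd]; exact h3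
    · rw [neg_dvd]; exact h4
  · exact family1_solutions_of_pos hb hb4 hpos h h3 h4

/-- With s = θ³ + aθ and s² = -b, integrality of s/x when x² ∣ b forces b squarefree, and
integrality of (1 + s)/2 when -b ≡ 1 mod 4 excludes b ≡ 3. The conjugate (-θ + ω)/2, with
denominator 2D, supplies the divisibilities by 2D. -/
theorem eq_of_isMonogenic_poly1 {a b : ℤ} (hM : IsMonogenic (poly1 a b))
    (hsq : IsSquare (4 * a ^ 3 * b - 27 * b ^ 2)) : (a = -3 ∧ b = -3) ∨ (a = 3 ∧ b = 1) := by
  obtain ⟨D, hD⟩ := hsq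
  have hD0 := poly1_disc_ne_zero hM.2.1 hD
  obtain ⟨θ, hθ⟩ := exists_complex_root (2 * a) (a ^ 2) b
  have hθ' : θ ^ 2 * (θ ^ 2 + a) ^ 2 + b = 0 := by
    have := hθ
    rwa [← poly1_eq, aeval_poly1] at this
  rw [poly1_eq] at hM
  have hb := const_ne_zero hM.2.1
  have hs2 : (θ ^ 3 + a * θ) ^ 2 = -b := by linear_combination hθ'
  have hsf : Squarefree b := by
    rintro x ⟨k, hk⟩
    have hx : x ≠ 0 := by rintro rfl; simp at hk; exact hb hk
    have hx' : (x : ℂ) ≠ 0 := by exact_mod_cast hx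
    have hk' : (b : ℂ) = x * x * k := by exact_mod_cast hk
    have hz : IsIntegral ℤ ((θ ^ 3 + a * θ) / x) :=
      isIntegral_of_quadratic (m := 0) (k := k) (by
        field_simp
        push_cast
        linear_combination hs2 - hk')
    have := (evenSextic_dvd_of_isMonogenic hM hθ hx (h₀ := 0) (h₁ := a) (h₂ := 0) (h₃ := 1)
      (h₄ := 0) (h₅ := 0) hz (by field_simp; push_cast; ring)).2.2.2.1
    exact isUnit_of_dvd_one this
  have hb4 : b % 4 ≠ 3 := by
    intro h
    obtain ⟨k, hk⟩ : ∃ k, b = 4 * k + 3 := ⟨b / 4, by omega⟩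
    have hk' : (b : ℂ) = 4 * k + 3 := by exact_mod_cast hk
    have hz : IsIntegral ℤ ((1 + (θ ^ 3 + a * θ)) / 2) :=
      isIntegral_of_quadratic (m := -1) (k := k + 1) (by
        push_cast
        linear_combination hs2 / 4 - hk' / 4)
    have := (evenSextic_dvd_of_isMonogenic hM hθ two_ne_zero (h₀ := 1) (h₁ := a) (h₂ := 0)
      (h₃ := 1) (h₄ := 0) (h₅ := 0) hz (by push_cast; ring)).1
    omega
  have hD0' : (D : ℂ) ≠ 0 := by exact_mod_cast hD0
  have hD' : (D : ℂ) ^ 2 = 4 * (a : ℂ) ^ 3 * b - 27 * (b : ℂ) ^ 2 := by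
    have : D ^ 2 = 4 * a ^ 3 * b - 27 * b ^ 2 := by rw [hD]; ring
    exact_mod_cast this
  obtain ⟨ω, hω⟩ : ∃ ω : ℂ,
      D * ω = -(θ ^ 3 + a * θ) * (9 * θ ^ 4 + 15 * a * θ ^ 2 + 4 * a ^ 2) :=
    ⟨_, mul_div_cancel₀ _ hD0'⟩
  have hβ := family1_root hθ' (family1_quadratic hD0' hD' hθ' hω)
  rw [← aeval_poly1, poly1_eq] at hβ
  obtain ⟨-, h1, -, -, -, h5⟩ := evenSextic_dvd_of_isMonogenic hM hθ (N := 2 * D)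
    (mul_ne_zero two_ne_zero hD0) (h₀ := 0) (h₁ := -(4 * a ^ 3 - 9 * b + D)) (h₂ := 0)
    -- The coefficients come from 2D·(-θ + ω)/2, with its θ⁷ term reduced by the equation of θ.
    (h₃ := -10 * a ^ 2) (h₄ := 0) (h₅ := -(6 * a)) (isIntegral_of_evenSextic hβ) (by
      push_cast
      linear_combination hω - 9 * θ * hθ')
  rw [dvd_neg] at h1 h5
  exact family1_solutions hb hb4 hsf hD0 hD h5 h1

/-- Since D² = 4(ab³ - 9) + 9, D divides 9 and ab³ is 7, 9 or 27. Then D ∣ b² and a ≢ 3 mod 4 leave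
two pairs. -/
theorem family2_solutions {a b D : ℤ} (ha4 : a % 4 ≠ 3) (hD : 4 * a * b ^ 3 - 27 = D * D)
    (h1 : D ∣ b ^ 2) (h2 : D ∣ a * b ^ 3 - 9) :
    (a = -7 ∧ b = -1) ∨ (a = 1 ∧ b = 3) := by
  have h9 : D ∣ 9 := by
    obtain ⟨k, hk⟩ := h2
    exact ⟨D - 4 * k, by linear_combination hD - 4 * hk⟩
  obtain ⟨e, he⟩ := h1
  have hb0 : b ≠ 0 := by
    rintro rfl
    nlinarith [mul_self_nonneg D]
  have hD1 : D ≤ 9 := Int.le_of_dvd (by norm_num) h9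
  have hD2 : -D ≤ 9 := Int.le_of_dvd (by norm_num) ((neg_dvd (a := D)).2 h9)
  have hD3 : -9 ≤ D := by omega
  have ht : 4 * (a * b ^ 3) - 27 = D * D := by linear_combination hD
  have bound : ∀ M : ℤ, 0 < M → M ≤ 27 → a * b ^ 3 = M → -3 ≤ b ∧ b ≤ 3 := by
    intro M hM0 hM27 hM
    have hdvd : b.natAbs ^ 3 ∣ M.natAbs := by
      rw [← Int.natAbs_pow, Int.natAbs_dvd_natAbs]
      exact ⟨a, by rw [← hM, mul_comm]⟩
    have hle := Nat.le_of_dvd (by omega) hdvd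
    have : b.natAbs ≤ 3 := by
      by_contra hlt
      have : 4 ^ 3 ≤ b.natAbs ^ 3 := Nat.pow_le_pow_left (by omega) 3
      omega
    omega
  have hcases : (D = 1 ∨ D = -1) ∨ (D = 3 ∨ D = -3) ∨ (D = 9 ∨ D = -9) := by
    have h9' : -D ∣ 9 := neg_dvd.2 h9
    interval_cases D <;> norm_num at h9' <;> omega
  rcases hcases with h | h | h
  · have hM : a * b ^ 3 = 7 := by rcases h with rfl | rfl <;> omega
    obtain ⟨h3, h4⟩ := bound _ (by norm_num) (by norm_num) hM
    interval_cases b <;> omega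
  · have hM : a * b ^ 3 = 9 := by rcases h with rfl | rfl <;> omega
    obtain ⟨h3, h4⟩ := bound _ (by norm_num) (by norm_num) hM
    rcases h with rfl | rfl <;> interval_cases b <;> omega
  · have hM : a * b ^ 3 = 27 := by rcases h with rfl | rfl <;> omega
    obtain ⟨h3, h4⟩ := bound _ (by norm_num) (by norm_num) hM
    rcases h with rfl | rfl <;> interval_cases b <;> omega

theorem eq_of_isMonogenic_poly2 {a b : ℤ} (hM : IsMonogenic (poly2 a b))
    (hsq : IsSquare (4 * a * b ^ 3 - 27)) : (a = -7 ∧ b = -1) ∨ (a = 1 ∧ b = 3) := by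
  obtain ⟨D, hD⟩ := hsq
  have hD0 : D ≠ 0 := by
    rintro rfl
    have : 4 * (a * b ^ 3) = 27 := by linear_combination hD
    omega
  obtain ⟨θ, hθ⟩ := exists_complex_root (a * b ^ 2) (2 * a * b) a
  have hθ' : θ ^ 6 + a * (b * θ ^ 2 + 1) ^ 2 = 0 := by
    have := hθ
    rwa [← poly2_eq, aeval_poly2] at this
  rw [poly2_eq] at hM
  obtain ⟨s, hs⟩ : ∃ s : ℂ, s = -b * θ ^ 5 + (1 - a * b ^ 3) * θ ^ 3 - a * b ^ 2 * θ := ⟨_, rfl⟩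
  have hs2 := family2_sq hθ' hs
  have ha4 : a % 4 ≠ 3 := by
    intro h
    obtain ⟨k, hk⟩ : ∃ k, a = 4 * k + 3 := ⟨a / 4, by omega⟩
    have hk' : (a : ℂ) = 4 * k + 3 := by exact_mod_cast hk
    have hz : IsIntegral ℤ ((1 + s) / 2) :=
      isIntegral_of_quadratic (m := -1) (k := k + 1) (by
        push_cast
        linear_combination hs2 / 4 - hk' / 4)
    have := (evenSextic_dvd_of_isMonogenic hM hθ two_ne_zero (h₀ := 1) (h₁ := -(a * b ^ 2))
      (h₂ := 0) (h₃ := 1 - a * b ^ 3) (h₄ := 0) (h₅ := -b) hz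
      (by push_cast; linear_combination hs)).1
    omega
  have hD0' : (D : ℂ) ≠ 0 := by exact_mod_cast hD0
  have hD' : (D : ℂ) ^ 2 = 4 * (a : ℂ) * b ^ 3 - 27 := by
    have : D ^ 2 = 4 * a * b ^ 3 - 27 := by rw [hD]; ring
    exact_mod_cast this
  obtain ⟨ω, hω⟩ : ∃ ω : ℂ,
      D * ω = -b ^ 2 * θ ^ 5 + (3 * b - a * b ^ 4) * θ ^ 3 + (a * b ^ 3 - 9) * θ :=
    ⟨_, mul_div_cancel₀ _ hD0'⟩
  have hβ := family2_root hs2 (family2_cube hθ' hs) (family2_quadratic hD0' hD' hθ' hs hω)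
  rw [← aeval_poly2, poly2_eq] at hβ
  obtain ⟨-, h1, -, -, -, h5⟩ := evenSextic_dvd_of_isMonogenic hM hθ (N := 2 * D)
    (mul_ne_zero two_ne_zero hD0) (h₀ := 0) (h₁ := D * (-(a * b ^ 3) - 1) + (a * b ^ 3 - 9))
    (h₂ := 0) (h₃ := D * (b * (1 - a * b ^ 3)) + (3 * b - a * b ^ 4)) (h₄ := 0)
    (h₅ := D * (-b ^ 2) - b ^ 2) (isIntegral_of_evenSextic hβ) (by
      push_cast
      linear_combination hω + D * b * hs)
  refine family2_solutions ha4 hD ?_ ?_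
  · exact (dvd_sub_right (dvd_mul_right D _)).1 ((dvd_mul_left D 2).trans h5)
  · exact (dvd_add_right (dvd_mul_right D _)).1 ((dvd_mul_left D 2).trans h1)

/-- The element w is integral, and Nw has θ⁴-coefficient 1, so N = n² + n - 1 must be ±1. -/
theorem mem_of_isMonogenic_poly3 {n : ℤ} (hM : IsMonogenic (poly3 n)) :
    n ∈ ({-2, -1, 0, 1} : Set ℤ) := by
  have hN0 := family3_index_ne_zero n
  rw [poly3_eq] at hM
  obtain ⟨θ, hθ⟩ := exists_complex_root ((n - 1) ^ 2 + 2 * (n - 1) + 6)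
    ((n - 1) ^ 2 + 4 * (n - 1) + 9) 1
  obtain ⟨α, hα⟩ : ∃ α, α = n - 1 := ⟨_, rfl⟩
  rw [← hα] at hM hθ hN0
  obtain ⟨N, hN⟩ : ∃ N, N = α ^ 2 + 3 * α + 1 := ⟨_, rfl⟩
  rw [← hN] at hN0
  have hN0' : (N : ℂ) ≠ 0 := by exact_mod_cast hN0
  have hN' : (N : ℂ) = (α : ℂ) ^ 2 + 3 * α + 1 := by exact_mod_cast hN
  have hθ' : θ ^ 6 + ((α : ℂ) ^ 2 + 2 * α + 6) * θ ^ 4 + ((α : ℂ) ^ 2 + 4 * α + 9) * θ ^ 2 + 1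
      = 0 := by
    have := hθ
    rw [aeval_evenSextic] at this
    exact_mod_cast this
  obtain ⟨w, hw⟩ : ∃ w : ℂ, N * w = θ ^ 4 + ((α : ℂ) ^ 2 + α + 3) * θ ^ 2 - α :=
    ⟨_, mul_div_cancel₀ _ hN0'⟩
  have hw3 := family3_cubic hN0' hθ' hN' hw
  have hwi : IsIntegral ℤ w := by
    refine ⟨X ^ 3 - C α * X ^ 2 - (C α + 3) * X - 1, by monicity!, ?_⟩
    change aeval w _ = 0
    simpa [map_ofNat (aeval w : ℤ[X] →ₐ[ℤ] ℂ) 3] using hw3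
  have h4 := (evenSextic_dvd_of_isMonogenic hM hθ hN0 (h₀ := -α) (h₁ := 0)
    (h₂ := α ^ 2 + α + 3) (h₃ := 0) (h₄ := 1) (h₅ := 0) hwi
    (by push_cast; linear_combination hw)).2.2.2.2.1
  have hn : n = α + 1 := by omega
  rcases Int.isUnit_iff.1 (isUnit_of_dvd_one h4) with h | h
  · have h0 : (n - 1) * (n + 2) = 0 := by rw [hn]; linear_combination hN.symm.trans h
    rcases mul_eq_zero.1 h0 with h | h
    · simp [show n = 1 by omega]
    · simp [show n = -2 by omega]
  · have h0 : n * (n + 1) = 0 := by rw [hn]; linear_combination hN.symm.trans h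
    rcases mul_eq_zero.1 h0 with h | h
    · simp [show n = 0 by omega]
    · simp [show n = -1 by omega]

/-! ### The families are infinite -/

theorem family1_infinite : family1.Infinite := by
  refine Set.infinite_of_injective_forall_mem
    -- For a = 3m, b = 3m³ the quantity 4a³b - 27b² is (9m³)²; m ≡ 1 mod 3 makes f Eisenstein at 3.
    (f := fun k : ℤ => poly1 (3 * (3 * k + 1)) (3 * (3 * k + 1) ^ 3)) ?_ fun k => ?_
  · intro k l h
    simp only [poly1_eq, evenSextic_inj] at h
    omega
  · refine ⟨_, _, rfl, ?_, 9 * (3 * k + 1) ^ 3, by ring⟩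
    rw [poly1_eq]
    refine irredOverQ_of_eisenstein Int.prime_three ⟨2 * (3 * k + 1), by ring⟩
      ⟨3 * (3 * k + 1) ^ 2, by ring⟩ ⟨(3 * k + 1) ^ 3, by ring⟩ ?_
    rintro ⟨m, hm⟩
    have : (3 * k + 1) ^ 3 = 3 * (9 * k ^ 3 + 9 * k ^ 2 + 3 * k) + 1 := by ring
    omega

theorem family2_infinite : family2.Infinite := by
  refine Set.infinite_of_injective_forall_mem
    -- Solves 4a - 27 = (98k + 1)² with a divisible by 7 but not by 49.
    (f := fun k : ℕ => poly2 (7 + 49 * k + 2401 * k ^ 2) 1) ?_ fun k => ?_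
  · intro k l h
    simp only [poly2_eq, evenSextic_inj] at h
    have h1 : ((k : ℤ) - l) * (49 + 2401 * (k + l)) = 0 := by linear_combination h.2.2
    rcases mul_eq_zero.1 h1 with h2 | h2 <;> omega
  · refine ⟨_, _, rfl, ?_, 98 * k + 1, by ring⟩
    rw [poly2_eq]
    refine irredOverQ_of_eisenstein (p := 7) (by norm_num) ⟨1 + 7 * k + 343 * k ^ 2, by ring⟩
      ⟨2 * (1 + 7 * k + 343 * k ^ 2), by ring⟩ ⟨1 + 7 * k + 343 * k ^ 2, by ring⟩ ?_
    rintro ⟨m, hm⟩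
    omega

theorem poly3_injective : Function.Injective poly3 := by
  intro n m h
  simp only [poly3, evenSextic_inj] at h
  linarith [h.1, h.2.1]

theorem family3_infinite : family3.Infinite := Set.infinite_range_of_injective poly3_injective

/-! ### Monogenicity certificates -/

/-- `f` is, modulo `p`, the power of an irreducible polynomial `φ`, and `(f - φ ^ (e + 1)) / p` is
prime to `φ` modulo `p`. -/
def IsEisensteinModulo (f : ℤ[X]) (p : ℕ) : Prop :=
  ∃ φ r u v w : ℤ[X], ∃ e : ℕ, f = φ ^ (e + 1) + C (p : ℤ) * r ∧
    Irreducible (φ.map (Int.castRingHom (ZMod p))) ∧ u * r + v * φ + C (p : ℤ) * w = 1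

theorem isMonogenic_of_eisensteinModulo {f : ℤ[X]} (hm : f.Monic) (hf : IrredOverQ f)
    {M : ℤ} {q i j : ℕ} (hM : M = 2 ^ i * q ^ j) {u v : ℤ[X]}
    (huv : u * derivative f + v * f = C M) (hq : q.Prime)
    (h2 : IsEisensteinModulo f 2) (hfq : IsEisensteinModulo f q) : IsMonogenic f := by
  refine isMonogenic_of_forall_integral hm hf fun θ hθ z hzθ hz =>
    exists_aeval_eq_of_saturated hm hθ (fun p hp h hh => ?_) hzθ hz
  by_cases hpM : (p : ℤ) ∣ M
  · have hpq : p = 2 ∨ p = q := by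
      have h1 : p ∣ 2 ^ i * q ^ j := by rw [hM] at hpM; exact_mod_cast hpM
      rcases (hp.dvd_mul).1 h1 with h1 | h1
      · exact Or.inl ((Nat.prime_dvd_prime_iff_eq hp Nat.prime_two).1 (hp.dvd_of_dvd_pow h1))
      · exact Or.inr ((Nat.prime_dvd_prime_iff_eq hp hq).1 (hp.dvd_of_dvd_pow h1))
    have hE : IsEisensteinModulo f p := by
      rcases hpq with rfl | rfl
      · exact h2
      · exact hfq
    obtain ⟨φ, r, u', v', w, e, hfe, hφ, hb⟩ := hE
    exact saturated_of_eisenstein hm hθ hp hfe hφ hb h hh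
  · exact saturated_of_separable hm hf hθ huv hp hpM h hh

theorem irreducible_map_X {p : ℕ} (hp : p.Prime) :
    Irreducible ((X : ℤ[X]).map (Int.castRingHom (ZMod p))) := by
  have : Fact p.Prime := ⟨hp⟩
  rw [map_X]; exact irreducible_X

theorem irreducible_cubic_mod {p : ℕ} (hp : p.Prime) {a b c : ℤ}
    (h : ∀ x : ZMod p, x ^ 3 + a * x ^ 2 + b * x + c ≠ 0) :
    Irreducible ((X ^ 3 + C a * X ^ 2 + C b * X + C c : ℤ[X]).map (Int.castRingHom (ZMod p))) := by
  have : Fact p.Prime := ⟨hp⟩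
  refine irreducible_of_degree_le_three_of_not_isRoot ?_ fun x hx => h x ?_
  · rw [Monic.natDegree_map (by monicity!)]
    rw [show (X ^ 3 + C a * X ^ 2 + C b * X + C c : ℤ[X]).natDegree = 3 by compute_degree!]
    simp
  · simpa [IsRoot, eval_map] using hx

theorem irreducible_quadratic_mod {p : ℕ} (hp : p.Prime) {c : ℤ}
    (h : ∀ x : ZMod p, x ^ 2 + c ≠ 0) :
    Irreducible ((X ^ 2 + C c : ℤ[X]).map (Int.castRingHom (ZMod p))) := by
  have : Fact p.Prime := ⟨hp⟩
  refine irreducible_of_degree_le_three_of_not_isRoot ?_ fun x hx => h x ?_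
  · rw [Monic.natDegree_map (by monicity!)]
    rw [show (X ^ 2 + C c : ℤ[X]).natDegree = 2 by compute_degree!]
    simp
  · simpa [IsRoot, eval_map] using hx

theorem irredOverQ_neg6_9_neg3 : IrredOverQ (evenSextic (-6) 9 (-3)) :=
  irredOverQ_of_eisenstein Int.prime_three ⟨-2, by norm_num⟩ ⟨3, by norm_num⟩
    ⟨-1, by norm_num⟩ (by norm_num)

/-- This and its five analogues exhibit uf' + vf = 2·q^j and a Dedekind decomposition at 2 and at q.
Modulo 2, g(x²) ≡ g(x)², so φ is the cubic and e = 1. Modulo q, f is X⁶ or the cube of an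
irreducible quadratic. -/
theorem isMonogenic_neg6_9_neg3 : IsMonogenic (evenSextic (-6) 9 (-3)) :=
  isMonogenic_of_eisensteinModulo (evenSextic_monic _ _ _) irredOverQ_neg6_9_neg3
    (M := 18) (q := 3) (i := 1) (j := 2) (by norm_num)
    (u := 2 * X ^ 5 - 10 * X ^ 3 + 9 * X) (v := -12 * X ^ 4 + 36 * X ^ 2 - 6)
    (by simp [evenSextic]; ring) (by norm_num)
    ⟨X ^ 3 + C 0 * X ^ 2 + C 1 * X + C 1, -4 * X ^ 4 - X ^ 3 + 4 * X ^ 2 - X - 2, 1, 1,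
      2 * X ^ 4 - 2 * X ^ 2 + 1, 1, by simp [evenSextic]; ring,
      irreducible_cubic_mod Nat.prime_two (by decide), by simp; ring⟩
    ⟨X, -2 * X ^ 4 + 3 * X ^ 2 - 1, 2, X ^ 3,
      X ^ 4 - 2 * X ^ 2 + 1, 5, by simp [evenSextic]; ring,
      irreducible_map_X (by norm_num), by simp; ring⟩

theorem irredOverQ_6_9_1 : IrredOverQ (evenSextic 6 9 1) :=
  irredOverQ_of_const_one (by norm_num) (by norm_num)

theorem isMonogenic_6_9_1 : IsMonogenic (evenSextic 6 9 1) :=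
  isMonogenic_of_eisensteinModulo (evenSextic_monic _ _ _) irredOverQ_6_9_1
    (M := 18) (q := 3) (i := 1) (j := 2) (by norm_num)
    (u := -2 * X ^ 5 - 10 * X ^ 3 - 11 * X) (v := 12 * X ^ 4 + 36 * X ^ 2 + 18)
    (by simp [evenSextic]; ring) (by norm_num)
    ⟨X ^ 3 + C 0 * X ^ 2 + C 1 * X + C 1, 2 * X ^ 4 - X ^ 3 + 4 * X ^ 2 - X, 1, 1,
      -X ^ 4 - 2 * X ^ 2, 1, by simp [evenSextic]; ring,
      irreducible_cubic_mod Nat.prime_two (by decide), by simp; ring⟩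
    ⟨X ^ 2 + C 1, X ^ 4 + 2 * X ^ 2, 2, X ^ 2 + 1,
      -X ^ 4 - 2 * X ^ 2, 2, by simp [evenSextic]; ring,
      irreducible_quadratic_mod (by norm_num) (by decide), by simp; ring⟩

theorem irredOverQ_neg7_14_neg7 : IrredOverQ (evenSextic (-7) 14 (-7)) :=
  irredOverQ_of_eisenstein (p := 7) (by norm_num) ⟨-1, by norm_num⟩ ⟨2, by norm_num⟩
    ⟨-1, by norm_num⟩ (by norm_num)

theorem isMonogenic_neg7_14_neg7 : IsMonogenic (evenSextic (-7) 14 (-7)) :=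
  isMonogenic_of_eisensteinModulo (evenSextic_monic _ _ _) irredOverQ_neg7_14_neg7
    (M := 14) (q := 7) (i := 1) (j := 1) (by norm_num)
    (u := X ^ 5 - 5 * X ^ 3 + 5 * X) (v := -6 * X ^ 4 + 16 * X ^ 2 - 2)
    (by simp [evenSextic]; ring) (by norm_num)
    ⟨X ^ 3 + C 1 * X ^ 2 + C 0 * X + C 1, -X ^ 5 - 4 * X ^ 4 - X ^ 3 + 6 * X ^ 2 - 4,
      X, X ^ 3 + X ^ 2 + 1,
      X ^ 5 - 4 * X ^ 3 - X ^ 2 + 2 * X, 1, by simp [evenSextic]; ring,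
      irreducible_cubic_mod Nat.prime_two (by decide), by simp; ring⟩
    ⟨X, -X ^ 4 + 2 * X ^ 2 - 1, 6, 6 * X ^ 3 + 2 * X,
      -2 * X ^ 2 + 1, 5, by simp [evenSextic]; ring,
      irreducible_map_X (by norm_num), by simp; ring⟩

theorem irredOverQ_9_6_1 : IrredOverQ (evenSextic 9 6 1) :=
  irredOverQ_of_const_one (by norm_num) (by norm_num)

theorem isMonogenic_9_6_1 : IsMonogenic (evenSextic 9 6 1) :=
  isMonogenic_of_eisensteinModulo (evenSextic_monic _ _ _) irredOverQ_9_6_1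
    (M := 18) (q := 3) (i := 1) (j := 2) (by norm_num)
    (u := -41 * X ^ 5 - 355 * X ^ 3 - 125 * X) (v := 246 * X ^ 4 + 1392 * X ^ 2 + 18)
    (by simp [evenSextic]; ring) (by norm_num)
    ⟨X ^ 3 + C 1 * X ^ 2 + C 0 * X + C 1, -X ^ 5 + 4 * X ^ 4 - X ^ 3 + 2 * X ^ 2,
      X, X ^ 3 + X ^ 2 + 1,
      -3 * X ^ 5 - 2 * X ^ 3 - X ^ 2, 1, by simp [evenSextic]; ring,
      irreducible_cubic_mod Nat.prime_two (by decide), by simp; ring⟩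
    ⟨X ^ 2 + C 1, 2 * X ^ 4 + X ^ 2, 1, X ^ 2 + 1,
      -X ^ 4 - X ^ 2, 2, by simp [evenSextic]; ring,
      irreducible_quadratic_mod (by norm_num) (by decide), by simp; ring⟩

theorem irredOverQ_6_5_1 : IrredOverQ (evenSextic 6 5 1) :=
  irredOverQ_of_const_one (by norm_num) (by norm_num)

theorem isMonogenic_6_5_1 : IsMonogenic (evenSextic 6 5 1) :=
  isMonogenic_of_eisensteinModulo (evenSextic_monic _ _ _) irredOverQ_6_5_1
    (M := 14) (q := 7) (i := 1) (j := 1) (by norm_num)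
    (u := -14 * X ^ 5 - 78 * X ^ 3 - 37 * X) (v := 84 * X ^ 4 + 300 * X ^ 2 + 14)
    (by simp [evenSextic]; ring) (by norm_num)
    ⟨X ^ 3 + C 0 * X ^ 2 + C 1 * X + C 1, 2 * X ^ 4 - X ^ 3 + 2 * X ^ 2 - X, 1, 1,
      -X ^ 4 - X ^ 2, 1, by simp [evenSextic]; ring,
      irreducible_cubic_mod Nat.prime_two (by decide), by simp; ring⟩
    ⟨X ^ 2 + C 2, -X ^ 2 - 1, 1, 1,
      0, 2, by simp [evenSextic]; ring,
      irreducible_quadratic_mod (by norm_num) (by decide), by simp; ring⟩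

theorem irredOverQ_5_6_1 : IrredOverQ (evenSextic 5 6 1) :=
  irredOverQ_of_const_one (by norm_num) (by norm_num)

theorem isMonogenic_5_6_1 : IsMonogenic (evenSextic 5 6 1) :=
  isMonogenic_of_eisensteinModulo (evenSextic_monic _ _ _) irredOverQ_5_6_1
    (M := 14) (q := 7) (i := 1) (j := 1) (by norm_num)
    (u := -3 * X ^ 5 - 13 * X ^ 3 - 11 * X) (v := 18 * X ^ 4 + 48 * X ^ 2 + 14)
    (by simp [evenSextic]; ring) (by norm_num)
    ⟨X ^ 3 + C 1 * X ^ 2 + C 0 * X + C 1, -X ^ 5 + 2 * X ^ 4 - X ^ 3 + 2 * X ^ 2,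
      X, X ^ 3 + X ^ 2 + 1,
      -2 * X ^ 5 - 2 * X ^ 3 - X ^ 2, 1, by simp [evenSextic]; ring,
      irreducible_cubic_mod Nat.prime_two (by decide), by simp; ring⟩
    ⟨X ^ 2 + C 4, -X ^ 4 - 6 * X ^ 2 - 9, 6, 6 * X ^ 2 + 5,
      X ^ 2 + 5, 2, by simp [evenSextic]; ring,
      irreducible_quadratic_mod (by norm_num) (by decide), by simp; ring⟩

/-! ### Supports, necessity of the square conditions, monogenic members -/

theorem galIsoC6_neg6_9_neg3 : GalIsoC6 (evenSextic (-6) 9 (-3)) := by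
  have h : poly1 (-3) (-3) = evenSextic (-6) 9 (-3) := by rw [poly1_eq]; norm_num
  rw [← h]
  exact galIsoC6_poly1 (h ▸ irredOverQ_neg6_9_neg3) ⟨9, by norm_num⟩

theorem galIsoC6_neg7_14_neg7 : GalIsoC6 (evenSextic (-7) 14 (-7)) := by
  have h : poly2 (-7) (-1) = evenSextic (-7) 14 (-7) := by rw [poly2_eq]; norm_num
  rw [← h]
  exact galIsoC6_poly2 (h ▸ irredOverQ_neg7_14_neg7) ⟨1, by norm_num⟩

theorem poly3_neg_two : poly3 (-2) = evenSextic 9 6 1 := by norm_num [poly3]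

theorem poly3_neg_one : poly3 (-1) = evenSextic 6 5 1 := by norm_num [poly3]

theorem poly3_zero : poly3 0 = evenSextic 5 6 1 := by norm_num [poly3]

theorem poly3_one : poly3 1 = evenSextic 6 9 1 := by norm_num [poly3]

theorem evenSextic_support {a b c : ℤ} (ha : a ≠ 0) (hb : b ≠ 0) (hc : c ≠ 0) :
    (evenSextic a b c).support = {0, 2, 4, 6} := by
  ext n
  rw [mem_support_iff, evenSextic_coeff]
  simp only [Finset.mem_insert, Finset.mem_singleton]
  split_ifs <;> simp_all

theorem evenSextic_support_card {a b c : ℤ} (ha : a ≠ 0) (hb : b ≠ 0) (hc : c ≠ 0) :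
    (evenSextic a b c).support.card = 4 := by
  rw [evenSextic_support ha hb hc]; rfl

theorem IsEvenPoly.coeff_of_odd {f : ℤ[X]} (hf : IsEvenPoly f) {n : ℕ} (hn : Odd n) :
    f.coeff n = 0 := by
  have h : f.comp (C (-1) * X) = f := by simpa [IsEvenPoly] using hf
  have h1 := congrArg (fun g => coeff g n) h
  simp only [comp_C_mul_X_coeff, hn.neg_one_pow] at h1
  omega

theorem IsEvenPoly.eq_evenSextic {f : ℤ[X]} (hf : IsEvenPoly f) (hm : f.Monic)
    (hd : f.natDegree = 6) : f = evenSextic (f.coeff 4) (f.coeff 2) (f.coeff 0) := by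
  ext n
  rw [evenSextic_coeff]
  split_ifs with h6 h4 h2 h0
  · rw [h6, ← hd]; exact hm
  · rw [h4]
  · rw [h2]
  · rw [h0]
  · rcases Nat.even_or_odd n with h | h
    · refine coeff_eq_zero_of_natDegree_lt ?_
      obtain ⟨m, rfl⟩ := h
      omega
    · exact hf.coeff_of_odd h

theorem not_galIsoC6_of_mul_eq_zero {a b c : ℤ} (hf : IrredOverQ (evenSextic a b c))
    (hab : a * b = 0) : ¬ GalIsoC6 (evenSextic a b c) := fun hG =>
  (mul_ne_zero (coeffs_of_galIsoC6 hf hG).2.1 (coeffs_of_galIsoC6 hf hG).2.2) hab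

theorem not_exists_even_trinomial :
    ¬ ∃ f : ℤ[X], f.natDegree = 6 ∧ IsEvenPoly f ∧ (f.support.card = 2 ∨ f.support.card = 3) ∧
      IsMonogenic f ∧ GalIsoC6 f := by
  rintro ⟨f, hd, he, hs, ⟨hm, hf, -⟩, hG⟩
  rw [he.eq_evenSextic hm hd] at hf hG hs
  obtain ⟨-, ha, hb⟩ := coeffs_of_galIsoC6 hf hG
  rw [evenSextic_support_card ha hb (const_ne_zero hf)] at hs
  omega

theorem isSquare_of_galIsoC6_poly1 {a b : ℤ} (hf : IrredOverQ (poly1 a b))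
    (hG : GalIsoC6 (poly1 a b)) : IsSquare (4 * a ^ 3 * b - 27 * b ^ 2) := by
  rw [poly1_eq] at hf hG
  have h := (coeffs_of_galIsoC6 hf hG).1
  convert h using 1
  ring

theorem isSquare_of_galIsoC6_poly2 {a b : ℤ} (hf : IrredOverQ (poly2 a b))
    (hG : GalIsoC6 (poly2 a b)) : IsSquare (4 * a * b ^ 3 - 27) := by
  rw [poly2_eq] at hf hG
  obtain ⟨D, hD⟩ := (coeffs_of_galIsoC6 hf hG).1
  have ha := const_ne_zero hf
  -- The discriminant of the cubic carries an extra factor a², which has to be cancelled.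
  have hD' : a ^ 2 * (4 * a * b ^ 3 - 27) = D ^ 2 := by linear_combination hD
  obtain ⟨e, rfl⟩ : a ∣ D := (Int.pow_dvd_pow_iff two_ne_zero).1 ⟨_, hD'.symm⟩
  exact ⟨e, mul_left_cancel₀ (pow_ne_zero 2 ha) (by linear_combination hD')⟩

theorem monogenic_family1 : {f ∈ family1 | IsMonogenic f} = monoSet1 := by
  ext f
  simp only [family1, monoSet1, Set.mem_ofPred_eq, Set.mem_insert_iff, Set.mem_singleton_iff]
  constructor
  · rintro ⟨⟨a, b, rfl, -, hsq⟩, hM⟩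
    rcases eq_of_isMonogenic_poly1 hM hsq with ⟨rfl, rfl⟩ | ⟨rfl, rfl⟩
    · left; rw [poly1_eq]; norm_num
    · right; rw [poly1_eq]; norm_num
  · rintro (rfl | rfl)
    · exact ⟨⟨-3, -3, by rw [poly1_eq]; norm_num, irredOverQ_neg6_9_neg3, 9, by norm_num⟩,
        isMonogenic_neg6_9_neg3⟩
    · exact ⟨⟨3, 1, by rw [poly1_eq]; norm_num, irredOverQ_6_9_1, 9, by norm_num⟩,
        isMonogenic_6_9_1⟩

theorem monogenic_family2 : {f ∈ family2 | IsMonogenic f} = monoSet2 := by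
  ext f
  simp only [family2, monoSet2, Set.mem_ofPred_eq, Set.mem_insert_iff, Set.mem_singleton_iff]
  constructor
  · rintro ⟨⟨a, b, rfl, -, hsq⟩, hM⟩
    rcases eq_of_isMonogenic_poly2 hM hsq with ⟨rfl, rfl⟩ | ⟨rfl, rfl⟩
    · left; rw [poly2_eq]; norm_num
    · right; rw [poly2_eq]; norm_num
  · rintro (rfl | rfl)
    · exact ⟨⟨-7, -1, by rw [poly2_eq]; norm_num, irredOverQ_neg7_14_neg7, 1, by norm_num⟩,
        isMonogenic_neg7_14_neg7⟩
    · exact ⟨⟨1, 3, by rw [poly2_eq]; norm_num, irredOverQ_9_6_1, 9, by norm_num⟩,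
        isMonogenic_9_6_1⟩

theorem isMonogenic_poly3_iff (n : ℤ) :
    IsMonogenic (poly3 n) ↔ n ∈ ({-2, -1, 0, 1} : Set ℤ) := by
  refine ⟨mem_of_isMonogenic_poly3, ?_⟩
  rintro (rfl | rfl | rfl | rfl)
  · rw [poly3_neg_two]; exact isMonogenic_9_6_1
  · rw [poly3_neg_one]; exact isMonogenic_6_5_1
  · rw [poly3_zero]; exact isMonogenic_5_6_1
  · rw [poly3_one]; exact isMonogenic_6_9_1

theorem monogenic_family3 : {f ∈ family3 | IsMonogenic f} = monoSet3 := by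
  ext f
  simp only [family3, monoSet3, Set.mem_ofPred_eq, Set.mem_insert_iff, Set.mem_singleton_iff,
    Set.mem_range]
  constructor
  · rintro ⟨⟨n, rfl⟩, hM⟩
    rcases (isMonogenic_poly3_iff n).1 hM with rfl | rfl | rfl | rfl <;> simp
  · rintro (rfl | rfl | rfl | rfl) <;>
      exact ⟨⟨_, rfl⟩, (isMonogenic_poly3_iff _).2 (by simp)⟩

/-! ### Comparison of splitting fields -/

theorem splittingFieldInC_reciprocal_le (a b : ℤ) :
    splittingFieldInC (evenSextic a b 1) ≤ splittingFieldInC (evenSextic b a 1) := by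
  rw [splittingFieldInC, adjoin_le_iff]
  intro θ hθ
  have hθ' : aeval θ (evenSextic a b 1) = 0 := hθ
  rw [aeval_evenSextic] at hθ'
  have h0 : θ ≠ 0 := by rintro rfl; simp at hθ'
  have hinv : aeval θ⁻¹ (evenSextic b a 1) = 0 := by
    rw [aeval_evenSextic]
    field_simp
    push_cast at hθ' ⊢
    linear_combination hθ'
  have hmem : θ⁻¹ ∈ splittingFieldInC (evenSextic b a 1) := subset_adjoin _ _ hinv
  simpa using inv_mem hmem

theorem splittingFieldInC_reciprocal (a b : ℤ) :
    splittingFieldInC (evenSextic a b 1) = splittingFieldInC (evenSextic b a 1) :=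
  le_antisymm (splittingFieldInC_reciprocal_le a b) (splittingFieldInC_reciprocal_le b a)

/-- A root η of the second polynomial is an integer of ℚ(θ), so η = p(θ) with p ∈ ℤ[x] by
monogenicity. Hence the first polynomial divides the second composed with p, and p carries roots
modulo m to roots. -/
theorem exists_root_mod_of_splittingFieldInC_eq {a b c a' b' c' : ℤ}
    (hM : IsMonogenic (evenSextic a b c)) (hG : GalIsoC6 (evenSextic a b c))
    (h : splittingFieldInC (evenSextic a b c) = splittingFieldInC (evenSextic a' b' c'))
    {m : ℕ} (r : ZMod m) (hr : r ^ 6 + a * r ^ 4 + b * r ^ 2 + c = 0) :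
    ∃ s : ZMod m, s ^ 6 + a' * s ^ 4 + b' * s ^ 2 + c' = 0 := by
  obtain ⟨θ, hθ⟩ := exists_complex_root a b c
  obtain ⟨η, hη⟩ := exists_complex_root a' b' c'
  have hmem : η ∈ ℚ⟮θ⟯ := by
    rw [← splittingFieldInC_eq_adjoin_simple hM.1 hM.2.1 (evenSextic_natDegree _ _ _) hG hθ, h]
    exact subset_adjoin _ _ hη
  obtain ⟨p, -, rfl⟩ := exists_aeval_of_isMonogenic hM hθ (isIntegral_of_evenSextic hη) hmem
  rw [← aeval_comp] at hη
  obtain ⟨g, hg⟩ := dvd_of_aeval_eq_zero hM.1 hM.2.1 hθ hη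
  refine ⟨aeval r p, ?_⟩
  rw [← aeval_evenSextic, ← aeval_comp, hg, map_mul, aeval_evenSextic, hr, zero_mul]

theorem splittingFieldInC_injOn : Set.InjOn splittingFieldInC fourQuadrinomials := by
  have hAB : splittingFieldInC (evenSextic (-6) 9 (-3)) ≠
      splittingFieldInC (evenSextic 6 9 1) := fun h => by
    obtain ⟨s, hs⟩ := exists_root_mod_of_splittingFieldInC_eq isMonogenic_neg6_9_neg3
      galIsoC6_neg6_9_neg3 h (m := 3) 0 (by decide)
    revert s; decide
  have hAC : splittingFieldInC (evenSextic (-6) 9 (-3)) ≠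
      splittingFieldInC (evenSextic (-7) 14 (-7)) := fun h => by
    obtain ⟨s, hs⟩ := exists_root_mod_of_splittingFieldInC_eq isMonogenic_neg6_9_neg3
      galIsoC6_neg6_9_neg3 h (m := 3) 0 (by decide)
    revert s; decide
  have hAF : splittingFieldInC (evenSextic (-6) 9 (-3)) ≠
      splittingFieldInC (evenSextic 5 6 1) := fun h => by
    obtain ⟨s, hs⟩ := exists_root_mod_of_splittingFieldInC_eq isMonogenic_neg6_9_neg3
      galIsoC6_neg6_9_neg3 h (m := 3) 0 (by decide)
    revert s; decide
  have hCB : splittingFieldInC (evenSextic (-7) 14 (-7)) ≠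
      splittingFieldInC (evenSextic 6 9 1) := fun h => by
    obtain ⟨s, hs⟩ := exists_root_mod_of_splittingFieldInC_eq isMonogenic_neg7_14_neg7
      galIsoC6_neg7_14_neg7 h (m := 7) 0 (by decide)
    revert s; decide
  have hCF : splittingFieldInC (evenSextic (-7) 14 (-7)) ≠
      splittingFieldInC (evenSextic 5 6 1) := fun h => by
    obtain ⟨s, hs⟩ := exists_root_mod_of_splittingFieldInC_eq isMonogenic_neg7_14_neg7
      galIsoC6_neg7_14_neg7 h (m := 7) 0 (by decide)
    revert s; decide
  have hFB : splittingFieldInC (evenSextic 5 6 1) ≠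
      splittingFieldInC (evenSextic 6 9 1) := fun h => by
    -- No ramified prime is needed here: 13 has a root for one polynomial and none for the other.
    have hr : ∃ r : ZMod 13, r ^ 6 + (5 : ℤ) * r ^ 4 + (6 : ℤ) * r ^ 2 + (1 : ℤ) = 0 := by decide
    obtain ⟨r, hr⟩ := hr
    obtain ⟨s, hs⟩ := exists_root_mod_of_splittingFieldInC_eq isMonogenic_5_6_1
      (poly3_zero ▸ galIsoC6_poly3 0) h r hr
    revert s; decide
  rintro f (rfl | rfl | rfl | rfl) g (rfl | rfl | rfl | rfl) h
  · rfl
  · exact absurd h hAB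
  · exact absurd h hAC
  · exact absurd h hAF
  · exact absurd h.symm hAB
  · rfl
  · exact absurd h.symm hCB
  · exact absurd h.symm hFB
  · exact absurd h.symm hAC
  · exact absurd h hCB
  · rfl
  · exact absurd h hCF
  · exact absurd h.symm hAF
  · exact absurd h hFB
  · exact absurd h.symm hCF
  · rfl

theorem fourQuadrinomials_ncard : fourQuadrinomials.ncard = 4 := by
  rw [fourQuadrinomials, Set.ncard_insert_of_notMem, Set.ncard_insert_of_notMem,
    Set.ncard_pair]
  all_goals simp [evenSextic_inj]

theorem fourQuadrinomials_subset : fourQuadrinomials ⊆ monoSet1 ∪ monoSet2 ∪ monoSet3 := by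
  rintro f (rfl | rfl | rfl | rfl)
  · exact Or.inl (Or.inl (Or.inl rfl))
  · exact Or.inl (Or.inl (Or.inr rfl))
  · exact Or.inl (Or.inr (Or.inl rfl))
  · exact Or.inr (Or.inr (Or.inr (Or.inl poly3_zero.symm)))

theorem mem_monoSets {f : ℤ[X]} (hf : f ∈ monoSet1 ∪ monoSet2 ∪ monoSet3) :
    f ∈ fourQuadrinomials ∨ f = evenSextic 9 6 1 ∨ f = evenSextic 6 5 1 := by
  simp only [monoSet1, monoSet2, monoSet3, fourQuadrinomials, Set.mem_union, Set.mem_insert_iff,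
    Set.mem_singleton_iff, poly3_neg_two, poly3_neg_one, poly3_zero, poly3_one] at hf ⊢
  tauto

theorem splittingFieldInC_image :
    splittingFieldInC '' (monoSet1 ∪ monoSet2 ∪ monoSet3) =
      splittingFieldInC '' fourQuadrinomials := by
  refine Set.Subset.antisymm ?_ (Set.image_mono fourQuadrinomials_subset)
  rintro _ ⟨f, hf, rfl⟩
  rcases mem_monoSets hf with h | rfl | rfl
  · exact ⟨f, h, rfl⟩
  · exact ⟨evenSextic 6 9 1, by simp [fourQuadrinomials], splittingFieldInC_reciprocal 6 9⟩
  · exact ⟨evenSextic 5 6 1, by simp [fourQuadrinomials], splittingFieldInC_reciprocal 5 6⟩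

theorem support_card_of_mem_monoSets {f : ℤ[X]} (hf : f ∈ monoSet1 ∪ monoSet2 ∪ monoSet3) :
    f.support.card = 4 := by
  rcases mem_monoSets hf with (rfl | rfl | rfl | rfl) | rfl | rfl <;>
    exact evenSextic_support_card (by norm_num) (by norm_num) (by norm_num)

theorem theorem1p1 :
    ((∀ a b c : ℤ, IrredOverQ (evenSextic a b c) → a * b = 0 → ¬ GalIsoC6 (evenSextic a b c)) ∧
      ¬ ∃ f : ℤ[X], f.natDegree = 6 ∧ IsEvenPoly f ∧ (f.support.card = 2 ∨ f.support.card = 3) ∧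
        IsMonogenic f ∧ GalIsoC6 f) ∧
    ((∀ a b : ℤ, IrredOverQ (poly1 a b) →
        (GalIsoC6 (poly1 a b) ↔ IsSquare (4 * a ^ 3 * b - 27 * b ^ 2))) ∧
      family1.Infinite ∧
      {f ∈ family1 | IsMonogenic f} = monoSet1) ∧
    ((∀ a b : ℤ, IrredOverQ (poly2 a b) →
        (GalIsoC6 (poly2 a b) ↔ IsSquare (4 * a * b ^ 3 - 27))) ∧
      family2.Infinite ∧
      {f ∈ family2 | IsMonogenic f} = monoSet2) ∧
    ((∀ n : ℤ, IrredOverQ (poly3 n) ∧ GalIsoC6 (poly3 n) ∧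
        (IsMonogenic (poly3 n) ↔ n ∈ ({-2, -1, 0, 1} : Set ℤ))) ∧
      family3.Infinite ∧
      {f ∈ family3 | IsMonogenic f} = monoSet3) ∧
    ((∀ f ∈ monoSet1 ∪ monoSet2 ∪ monoSet3, f.support.card = 4) ∧
      fourQuadrinomials ⊆ monoSet1 ∪ monoSet2 ∪ monoSet3 ∧
      fourQuadrinomials.ncard = 4 ∧
      Set.InjOn splittingFieldInC fourQuadrinomials ∧
      splittingFieldInC '' (monoSet1 ∪ monoSet2 ∪ monoSet3) =
        splittingFieldInC '' fourQuadrinomials ∧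
      (splittingFieldInC '' (monoSet1 ∪ monoSet2 ∪ monoSet3)).ncard = 4) := by
  refine ⟨⟨fun a b c => not_galIsoC6_of_mul_eq_zero, not_exists_even_trinomial⟩,
    ⟨fun a b hf => ⟨isSquare_of_galIsoC6_poly1 hf, galIsoC6_poly1 hf⟩, family1_infinite,
      monogenic_family1⟩,
    ⟨fun a b hf => ⟨isSquare_of_galIsoC6_poly2 hf, galIsoC6_poly2 hf⟩, family2_infinite,
      monogenic_family2⟩,
    ⟨fun n => ⟨irredOverQ_poly3 n, galIsoC6_poly3 n, isMonogenic_poly3_iff n⟩, family3_infinite,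
      monogenic_family3⟩,
    fun f => support_card_of_mem_monoSets, fourQuadrinomials_subset, fourQuadrinomials_ncard,
    splittingFieldInC_injOn, splittingFieldInC_image, ?_⟩
  rw [splittingFieldInC_image, splittingFieldInC_injOn.ncard_image, fourQuadrinomials_ncard]
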